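/- **Model.** Let $V\subset\mathbb R^3$ be open with positive finite measure. Let $V_{u_i}$ ($i\le m_u$), $V_{R_i}$ ($i\le m_R$) and $V_j^*$ ($j\le n$) be measurable subsets of $V$ of positive measure; the measure of a region is denoted by the same letter. Put $m=m_u+m_R$. For inputs $Q(t)\in\mathbb R^n$ consider the cascade $$u_t=-\tfrac1\beta\nabla\!\cdot q+\tfrac1\beta\sum_{j=1}^n\mathcal B_j(x)Q_j(t),\qquad q=-\tfrac{k(x)}{\eta(x)}\nabla u,\qquad q\cdot\hat e=0\ \text{on }\partial V,$$ $$R_t=R\{-\gamma_1u_t-\gamma_2(R-R^*)\},\qquad R>0,$$ with $\mathcal B_j=\mathbf 1_{V_j^*}/V_j^*$, $\beta>0$, $R^*\in L^2(V)$. The boundary condition and the divergence are understood weakly (tested against $H^1(V)$). A solution on $[0,\tau)$, $0<\tau\le\infty$, has $u\in C^0([0,\tau);H^1(V))$, $u_t\in L^2_{loc}([0,\tau);L^2(V))$, $R\in L^2_{loc}([0,\tau);L^2(V))$, and $u_t(t),R(t),R_t(t)\in H^1(V)$ for almost all $t$; $u$ and $R$ are the time integrals of $u_t$ and $R_t$.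 For references $r_u,r_R$ and nominal constants $\beta_0,\gamma_{1_0},R_0^*>0$ let $\sigma=(\sigma_u,\sigma_R)\in\mathbb R^m$, $$\sigma_{u_i}=\frac1{V_{u_i}}\int_{V_{u_i}}u\,dV-r_{u_i},\qquad \sigma_{R_i}=\frac1{\gamma_{1_0}R_0^*}\Big(\frac1{V_{R_i}}\int_{V_{R_i}}R\,dV-r_{R_i}\Big).$$ Then $\dot\sigma=\Psi(t)+B(t)Q(t)$, where $\Psi$ has the entries $$-\frac1{\beta V_{u_i}}\int_{V_{u_i}}\nabla\!\cdot q\,dV-\dot r_{u_i},$$ $$\frac1{\gamma_{1_0}R_0^*}\Big(\frac1{\beta V_{R_i}}\int_{V_{R_i}}\gamma_1R\,\nabla\!\cdot q\,dV-\frac1{V_{R_i}}\int_{V_{R_i}}\gamma_2R^2dV+\frac1{V_{R_i}}\int_{V_{R_i}}\gamma_2RR^*dV-\dot r_{R_i}\Big),$$ and $B$ has the entries $\frac1{\beta V_{u_i}}$ if $V_j^*\subset V_{u_i}$, respectively $-\frac{1}{\gamma_{1_0}R_0^*\beta V_{R_i}V_j^*}\int_{V_j^*}\gamma_1R\,dV$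 if $V_j^*\subset V_{R_i}$, and $0$ otherwise. The nominal matrix $B_0$ has the entries $\frac1{\beta_0V_{u_i}}$ if $V_j^*\subset V_{u_i}$, respectively $-\frac1{\beta_0V_{R_i}}$ if $V_j^*\subset V_{R_i}$, and $0$ otherwise. **Assumptions.** (i) $r_u,r_R$ are bounded on $[0,\infty)$ together with their first and second derivatives. (ii) On $V$ (and for all $t\ge0$) $\|k\|,\eta,R^*,\gamma_1,\gamma_2$ lie between positive constants, and $\partial_t\gamma_1,\partial_t\gamma_2$ are bounded. (iii) $V_{u_i}\cap V_{R_j}=\emptyset$ for all $i,j$; $m\le n$; each $V_{u_i}$ and each $V_{R_i}$ contains some $V_j^*$; the $V_j^*$ are pairwise disjoint; each $V_j^*$ is contained in or disjoint from each output region; $B_0$ has full row rank. **Control.** With $B_0^+=B_0^T(B_0B_0^T)^{-1}$, $$Q=B_0^+[-k_1\phi_1(\sigma)+b\nu],\qquad\dot\nu=-k_2\phi_2(\sigma),$$ $$\phi_1(\sigma)=(\alpha_1\|\sigma\|^{-1/2}+\alpha_2)\sigma,\qquad \phi_2(\sigma)=(\tfrac12\alpha_1\|\sigma\|^{-1/2}+\alpha_2)\phi_1(\sigma),$$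 where $\nu$ is absolutely continuous and its equation is understood in the sense of Filippov. **Theorem 1.** Let $\alpha_1,\alpha_2,b>0$, let $\delta_B\in(0,1)$ and $\delta_1,\dots,\delta_4>0$, and let $\bar k_2>0$ and $\bar k_1>\sqrt{b\bar k_2/(1-\delta_B)}$. There is $l_0>0$ such that for every $l\ge l_0$ and every model as above satisfying (i)–(iii), the control with $k_1=l\bar k_1$, $k_2=l^2\bar k_2$ has the following property. Consider all closed-loop solutions, on intervals $[0,\tau)$ with $0<\tau\le\infty$, along which $B(t)=[I_m+\Delta B(t)]B_0$ and $\Psi=\Psi_1+\Psi_2$ with $$\|\Delta B(t)\|\le\delta_B,\qquad\|\Psi_1(t)\|\le\delta_1\|\sigma(t)\|^{1/2}+\delta_2\|\sigma(t)\|,\qquad\|\tfrac{d}{dt}\bar\Psi_2(t)\|\le\delta_3+\delta_4\|\sigma(t)\|$$ for almost all $t$, where $\bar\Psi_2=\frac1b(I_m+\Delta B)^{-1}\Psi_2$ is (almost everywhere equal to) a locally absolutely continuous function and $\|\Delta B\|$ is the spectral norm. For these solutions the origin of the error dynamics, in the variables $(\sigma,\nu+\bar\Psi_2)$, is locally finite-time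 stable: for every $\varepsilon>0$ there is $\eta>0$ such that solutions starting in the $\eta$-ball stay in the $\varepsilon$-ball on $[0,\tau)$, and there are $r>0$ and $T_s>0$ such that every solution starting in the $r$-ball satisfies $\sigma(t)=0$ and $\nu(t)+\bar\Psi_2(t)=0$ for all $t\in[T_s,\tau)$. -/

import Mathlib

open MeasureTheory Set Filter Topology
open scoped ContDiff

noncomputable section

namespace Seismicity

/-- Physical space. -/
abbrev E3 : Type := EuclideanSpace ℝ (Fin 3)

/-- The output space `ℝ^m`, `m = m_u + m_R`, with its Euclidean norm. The first block of
coordinates belongs to the pressure outputs, the second one to the seismicity-rate outputs. -/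
abbrev Out (mu mR : ℕ) : Type := EuclideanSpace ℝ (Fin mu ⊕ Fin mR)

/-- The time interval `[0, τ)`; `τ = ⊤` gives `[0, ∞)`. -/
def horizon (τ : EReal) : Set ℝ := {t | 0 ≤ t ∧ (t : EReal) < τ}

/-! ### Sobolev notions -/

/-- `g` is the distributional gradient of `f` on the open set `V`. -/
def HasWeakGradient (V : Set E3) (f : E3 → ℝ) (g : E3 → E3) : Prop :=
  ∀ φ : E3 → ℝ, ContDiff ℝ ∞ φ → HasCompactSupport φ → tsupport φ ⊆ V →
    ∫ x in V, f x • gradient φ x = - ∫ x in V, φ x • g x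

/-- `f ∈ H¹(V)`, with weak gradient `g`. -/
def IsH1With (V : Set E3) (f : E3 → ℝ) (g : E3 → E3) : Prop :=
  MemLp f 2 (volume.restrict V) ∧ MemLp g 2 (volume.restrict V) ∧ HasWeakGradient V f g

/-- `f ∈ H¹(V)`. -/
def MemH1 (V : Set E3) (f : E3 → ℝ) : Prop := ∃ g : E3 → E3, IsH1With V f g

/-- `d ∈ L²(V)` is the divergence of `q ∈ L²(V)³`, and the normal component of `q` vanishes on the
boundary of `V` (both in the weak sense, by testing against all of `H¹(V)`). -/
def HasWeakDivNoFlux (V : Set E3) (q : E3 → E3) (d : E3 → ℝ) : Prop :=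
  MemLp q 2 (volume.restrict V) ∧ MemLp d 2 (volume.restrict V) ∧
    ∀ (φ : E3 → ℝ) (g : E3 → E3), IsH1With V φ g →
      ∫ x in V, inner ℝ (q x) (g x) = - ∫ x in V, d x * φ x

/-! ### Filippov regularization and finite-time stability -/

/-- The Filippov set-valued regularization of a vector field `f` at `x`. -/
def filippov {E : Type*} [NormedAddCommGroup E] [NormedSpace ℝ E] [MeasureSpace E]
    (f : E → E) (x : E) : Set E :=
  ⋂ (ε : ℝ) (_ : 0 < ε) (N : Set E) (_ : volume N = 0),
    closure (convexHull ℝ (f '' (Metric.ball x ε \ N)))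

/-- Local finite-time stability of the origin for a family of trajectories; `F τ x` says that `x`
is a trajectory of the system on `[0, τ)`. The origin is Lyapunov stable, and all trajectories that
start in some fixed ball are at the origin from some fixed settling time on. -/
def LocallyFiniteTimeStable {E : Type*} [NormedAddCommGroup E]
    (F : EReal → (ℝ → E) → Prop) : Prop :=
  (∀ ε : ℝ, 0 < ε → ∃ η : ℝ, 0 < η ∧ ∀ (τ : EReal) (x : ℝ → E), F τ x → ‖x 0‖ < η →
    ∀ t ∈ horizon τ, ‖x t‖ < ε) ∧
  (∃ r : ℝ, 0 < r ∧ ∃ Ts : ℝ, 0 < Ts ∧ ∀ (τ : EReal) (x : ℝ → E), F τ x → ‖x 0‖ < r →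
    ∀ t ∈ horizon τ, Ts ≤ t → x t = 0)

/-! ### The model -/

/-- The data of the diffusion / seismicity-rate cascade with `mu` pressure outputs, `mR`
seismicity-rate outputs and `n` inputs. Time is the first argument of functions of `(t, x)`. -/
structure Model (mu mR n : ℕ) where
  /-- the reservoir -/
  V : Set E3
  /-- regions of the pressure outputs -/
  Vu : Fin mu → Set E3
  /-- regions of the seismicity-rate outputs -/
  VR : Fin mR → Set E3
  /-- regions of the inputs -/
  Vs : Fin n → Set E3
  β : ℝ
  k : E3 → Matrix (Fin 3) (Fin 3) ℝ
  η : E3 → ℝ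
  γ₁ : ℝ → E3 → ℝ
  γ₂ : ℝ → E3 → ℝ
  Rstar : E3 → ℝ
  /-- pressure references -/
  ru : ℝ → EuclideanSpace ℝ (Fin mu)
  /-- seismicity-rate references -/
  rR : ℝ → EuclideanSpace ℝ (Fin mR)
  /-- nominal value of `β` -/
  β0 : ℝ
  /-- nominal value of `γ₁` -/
  γ10 : ℝ
  /-- nominal value of `Rstar` -/
  Rstar0 : ℝ

/-- The parameters of the generalized super-twisting control. -/
structure Gains where
  α₁ : ℝ
  α₂ : ℝ
  b : ℝ
  k₁ : ℝ
  k₂ : ℝ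

/-- The functions that make up a trajectory of the closed loop. -/
structure Trajectory (mu mR : ℕ) where
  /-- pressure change -/
  u : ℝ → E3 → ℝ
  /-- time derivative of `u` -/
  ut : ℝ → E3 → ℝ
  /-- spatial gradient of `u` -/
  gradu : ℝ → E3 → E3
  /-- divergence of the flux `q` -/
  divq : ℝ → E3 → ℝ
  /-- seismicity rate -/
  R : ℝ → E3 → ℝ
  /-- integral state of the controller -/
  ν : ℝ → Out mu mR

/-- Time derivative on `[0, ∞)` (one-sided at `0`). -/
def dot {E : Type*} [NormedAddCommGroup E] [NormedSpace ℝ E] (r : ℝ → E) (t : ℝ) : E :=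
  derivWithin r (Ici 0) t

/-- `r` is twice differentiable on `[0, ∞)`, and `r`, its first and its second derivative are
bounded there. -/
def BoundedWithTwoDerivatives {E : Type*} [NormedAddCommGroup E] [NormedSpace ℝ E]
    (r : ℝ → E) : Prop :=
  DifferentiableOn ℝ r (Ici 0) ∧ DifferentiableOn ℝ (dot r) (Ici 0) ∧
    ∃ L L' L'' : ℝ, ∀ t : ℝ, 0 ≤ t → ‖r t‖ ≤ L ∧ ‖dot r t‖ ≤ L' ∧ ‖dot (dot r) t‖ ≤ L''

/-- Bounds on a coefficient `γ(t, x)`: it is between two positive constants and has a bounded time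
derivative. -/
def CoefficientBounds (V : Set E3) (γ : ℝ → E3 → ℝ) : Prop :=
  ∃ m M L : ℝ, 0 < m ∧ ∀ x ∈ V,
    DifferentiableOn ℝ (fun t => γ t x) (Ici 0) ∧
    ∀ t : ℝ, 0 ≤ t → m ≤ γ t x ∧ γ t x ≤ M ∧ |dot (fun s => γ s x) t| ≤ L

/-- The operator of a square matrix on Euclidean space; its norm is the spectral norm of the
matrix. -/
abbrev op {ι : Type*} [Fintype ι] [DecidableEq ι] (A : Matrix ι ι ℝ) :
    EuclideanSpace ℝ ι →L[ℝ] EuclideanSpace ℝ ι :=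
  Matrix.toEuclideanCLM (𝕜 := ℝ) A

namespace Model

variable {mu mR n : ℕ}

/-- Source shape `𝓑ⱼ(x)`: normalized indicator of the input region. -/
def source (M : Model mu mR n) (j : Fin n) (x : E3) : ℝ :=
  (M.Vs j).indicator (fun _ => 1 / volume.real (M.Vs j)) x

/-- Darcy flux `q = -(k/η) ∇u`. -/
def flux (M : Model mu mR n) (X : Trajectory mu mR) (t : ℝ) (x : E3) : E3 :=
  -((1 / M.η x) • op (M.k x) (X.gradu t x))

/-- Right-hand side of the seismicity-rate equation. -/
def Rt (M : Model mu mR n) (X : Trajectory mu mR) (t : ℝ) (x : E3) : ℝ :=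
  X.R t x * (-(M.γ₁ t x) * X.ut t x - M.γ₂ t x * (X.R t x - M.Rstar x))

/-- The error vector `σ = (σ_u, σ_R)`: the averaged outputs minus their references, with the second
block scaled by `1 / (γ10 Rstar0)`. -/
def σ (M : Model mu mR n) (X : Trajectory mu mR) (t : ℝ) : Out mu mR :=
  WithLp.toLp 2 (Sum.elim
    (fun i => 1 / volume.real (M.Vu i) * (∫ x in M.Vu i, X.u t x) - M.ru t i)
    (fun i => 1 / (M.γ10 * M.Rstar0) *
      (1 / volume.real (M.VR i) * (∫ x in M.VR i, X.R t x) - M.rR t i)))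

/-- The perturbation term `Ψ` of the error dynamics `σ̇ = Ψ + B Q`. -/
def Ψ (M : Model mu mR n) (X : Trajectory mu mR) (t : ℝ) : Out mu mR :=
  WithLp.toLp 2 (Sum.elim
    (fun i => -(1 / (M.β * volume.real (M.Vu i))) * (∫ x in M.Vu i, X.divq t x) - dot M.ru t i)
    (fun i =>
      1 / (M.γ10 * M.Rstar0 * M.β * volume.real (M.VR i)) *
        (∫ x in M.VR i, M.γ₁ t x * X.R t x * X.divq t x)
      - 1 / (M.γ10 * M.Rstar0 * volume.real (M.VR i)) *
        (∫ x in M.VR i, M.γ₂ t x * X.R t x ^ 2)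
      + 1 / (M.γ10 * M.Rstar0 * volume.real (M.VR i)) *
        (∫ x in M.VR i, M.γ₂ t x * X.R t x * M.Rstar x)
      - 1 / (M.γ10 * M.Rstar0) * dot M.rR t i))

open Classical in
/-- The control coefficient `B(t)` of the error dynamics. -/
def B (M : Model mu mR n) (X : Trajectory mu mR) (t : ℝ) :
    Matrix (Fin mu ⊕ Fin mR) (Fin n) ℝ :=
  Matrix.of (Sum.elim
    (fun i j => if M.Vs j ⊆ M.Vu i then 1 / (M.β * volume.real (M.Vu i)) else 0)
    (fun i j => if M.Vs j ⊆ M.VR i then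
      -(1 / (M.γ10 * M.Rstar0 * M.β * volume.real (M.VR i) * volume.real (M.Vs j))) *
        (∫ x in M.Vs j, M.γ₁ t x * X.R t x) else 0))

open Classical in
/-- The nominal control coefficient `B₀`. -/
def B0 (M : Model mu mR n) : Matrix (Fin mu ⊕ Fin mR) (Fin n) ℝ :=
  Matrix.of (Sum.elim
    (fun i j => if M.Vs j ⊆ M.Vu i then 1 / (M.β0 * volume.real (M.Vu i)) else 0)
    (fun i j => if M.Vs j ⊆ M.VR i then -(1 / (M.β0 * volume.real (M.VR i))) else 0))

/-- The right pseudoinverse of `B₀`. -/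
def B0pinv (M : Model mu mR n) : Matrix (Fin n) (Fin mu ⊕ Fin mR) ℝ :=
  M.B0.transpose * (M.B0 * M.B0.transpose)⁻¹

/-- Geometry, nominal constants and measurability. -/
structure Basic (M : Model mu mR n) : Prop where
  isOpen_V : IsOpen M.V
  volume_V : 0 < volume M.V ∧ volume M.V < ⊤
  Vu_region : ∀ i, MeasurableSet (M.Vu i) ∧ M.Vu i ⊆ M.V ∧ 0 < volume (M.Vu i)
  VR_region : ∀ i, MeasurableSet (M.VR i) ∧ M.VR i ⊆ M.V ∧ 0 < volume (M.VR i)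
  Vs_region : ∀ j, MeasurableSet (M.Vs j) ∧ M.Vs j ⊆ M.V ∧ 0 < volume (M.Vs j)
  β_pos : 0 < M.β
  β0_pos : 0 < M.β0
  γ10_pos : 0 < M.γ10
  Rstar0_pos : 0 < M.Rstar0
  k_meas : ∀ i j, AEMeasurable (fun x => M.k x i j) (volume.restrict M.V)
  η_meas : AEMeasurable M.η (volume.restrict M.V)
  γ₁_meas : AEMeasurable (Function.uncurry M.γ₁)
    ((volume.restrict (Ici 0)).prod (volume.restrict M.V))
  γ₂_meas : AEMeasurable (Function.uncurry M.γ₂)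
    ((volume.restrict (Ici 0)).prod (volume.restrict M.V))
  Rstar_memLp : MemLp M.Rstar 2 (volume.restrict M.V)

/-- The references are bounded, with their first two derivatives. -/
structure ReferenceAssumption (M : Model mu mR n) : Prop where
  ru_bdd : BoundedWithTwoDerivatives M.ru
  rR_bdd : BoundedWithTwoDerivatives M.rR

/-- The bounds on the uncertain coefficients. -/
structure CoefficientAssumption (M : Model mu mR n) : Prop where
  k_bdd : ∃ m L : ℝ, 0 < m ∧ ∀ x ∈ M.V, m ≤ ‖op (M.k x)‖ ∧ ‖op (M.k x)‖ ≤ L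
  η_bdd : ∃ m L : ℝ, 0 < m ∧ ∀ x ∈ M.V, m ≤ M.η x ∧ M.η x ≤ L
  Rstar_bdd : ∃ m L : ℝ, 0 < m ∧ ∀ x ∈ M.V, m ≤ M.Rstar x ∧ M.Rstar x ≤ L
  γ₁_bdd : CoefficientBounds M.V M.γ₁
  γ₂_bdd : CoefficientBounds M.V M.γ₂

/-- The position of the input regions relative to the output regions. The rows of `B₀` are
independent, that is, `B₀` has a right (pseudo)inverse; and an input region meets an output region
only if it is contained in it, as the entries of `B(t)` presuppose. -/
structure RegionAssumption (M : Model mu mR n) : Prop where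
  outputs_disjoint : ∀ i j, Disjoint (M.Vu i) (M.VR j)
  outputs_le_inputs : mu + mR ≤ n
  input_in_Vu : ∀ i, ∃ j, M.Vs j ⊆ M.Vu i
  input_in_VR : ∀ i, ∃ j, M.Vs j ⊆ M.VR i
  inputs_disjoint : Pairwise fun i j => Disjoint (M.Vs i) (M.Vs j)
  inside_or_outside_Vu : ∀ j i, M.Vs j ⊆ M.Vu i ∨ Disjoint (M.Vs j) (M.Vu i)
  inside_or_outside_VR : ∀ j i, M.Vs j ⊆ M.VR i ∨ Disjoint (M.Vs j) (M.VR i)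
  B0_rows : LinearIndependent ℝ (fun i => M.B0 i)

/-- The model satisfies all its standing assumptions. -/
structure Admissible (M : Model mu mR n) : Prop where
  basic : M.Basic
  references : M.ReferenceAssumption
  coefficients : M.CoefficientAssumption
  regions : M.RegionAssumption

end Model

/-! ### The control -/

/-- `φ₁(s) = (α₁ ‖s‖^{-1/2} + α₂) s`. -/
def Gains.φ₁ (G : Gains) {mu mR : ℕ} (s : Out mu mR) : Out mu mR :=
  (G.α₁ * ‖s‖ ^ (-(1 / 2) : ℝ) + G.α₂) • s

/-- `φ₂(s) = (α₁ ‖s‖^{-1/2} / 2 + α₂) φ₁(s)`. -/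
def Gains.φ₂ (G : Gains) {mu mR : ℕ} (s : Out mu mR) : Out mu mR :=
  ((1 / 2) * G.α₁ * ‖s‖ ^ (-(1 / 2) : ℝ) + G.α₂) • G.φ₁ s

namespace Model

variable {mu mR n : ℕ}

/-- The control `Q = B₀⁺ (-k₁ φ₁(σ) + b ν)`. -/
def Q (M : Model mu mR n) (G : Gains) (X : Trajectory mu mR) (t : ℝ) : Fin n → ℝ :=
  M.B0pinv.mulVec (WithLp.ofLp (-(G.k₁ • G.φ₁ (M.σ X t)) + G.b • X.ν t))

/-- `X` is a solution on `[0, τ)` of the diffusion equation with no-flux boundary condition and of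
the seismicity-rate equation, driven by the control with gains `G`. -/
structure IsSolution (M : Model mu mR n) (G : Gains) (τ : EReal) (X : Trajectory mu mR) :
    Prop where
  /-- `u` is a continuous curve in `H¹(V)` -/
  u_H1 : ∀ t ∈ horizon τ, IsH1With M.V (X.u t) (X.gradu t)
  u_cont : ∀ t ∈ horizon τ,
    Tendsto (fun s => eLpNorm (X.u s - X.u t) 2 (volume.restrict M.V)) (𝓝[horizon τ] t) (𝓝 0)
  gradu_cont : ∀ t ∈ horizon τ,
    Tendsto (fun s => eLpNorm (X.gradu s - X.gradu t) 2 (volume.restrict M.V))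
      (𝓝[horizon τ] t) (𝓝 0)
  /-- `ut` is the time derivative of `u` -/
  ut_H1 : ∀ᵐ t ∂(volume.restrict (horizon τ)), MemH1 M.V (X.ut t)
  ut_memLp : ∀ T ∈ horizon τ, MemLp (Function.uncurry X.ut) 2
    ((volume.restrict (Icc 0 T)).prod (volume.restrict M.V))
  u_eq : ∀ t ∈ horizon τ, ∀ᵐ x ∂(volume.restrict M.V),
    X.u t x = X.u 0 x + ∫ s in (0 : ℝ)..t, X.ut s x
  /-- the diffusion equation, with its boundary condition -/
  divq_spec : ∀ᵐ t ∂(volume.restrict (horizon τ)),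
    HasWeakDivNoFlux M.V (M.flux X t) (X.divq t)
  diffusion : ∀ᵐ t ∂(volume.restrict (horizon τ)), ∀ᵐ x ∂(volume.restrict M.V),
    X.ut t x = -(1 / M.β) * X.divq t x + (1 / M.β) * ∑ j, M.source j x * M.Q G X t j
  /-- the seismicity-rate equation -/
  R_pos : ∀ t ∈ horizon τ, ∀ᵐ x ∂(volume.restrict M.V), 0 < X.R t x
  R_H1 : ∀ᵐ t ∂(volume.restrict (horizon τ)), MemH1 M.V (X.R t) ∧ MemH1 M.V (M.Rt X t)
  R_memLp : ∀ T ∈ horizon τ, MemLp (Function.uncurry X.R) 2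
    ((volume.restrict (Icc 0 T)).prod (volume.restrict M.V))
  R_eq : ∀ t ∈ horizon τ, ∀ᵐ x ∂(volume.restrict M.V),
    X.R t x = X.R 0 x + ∫ s in (0 : ℝ)..t, M.Rt X s x
  /-- the integral part of the controller, `ν̇ = -k₂ φ₂(σ)` in the sense of Filippov -/
  ν_ac : ∀ T ∈ horizon τ, AbsolutelyContinuousOnInterval X.ν 0 T
  ν_eq : ∀ᵐ t ∂(volume.restrict (horizon τ)),
    ∃ s ∈ filippov (G.φ₂ (mu := mu) (mR := mR)) (M.σ X t), HasDerivAt X.ν (-(G.k₂ • s)) t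

/-- The constants in the bounds on the uncertain control coefficient and on the perturbation. -/
structure Bounds where
  δB : ℝ
  δ₁ : ℝ
  δ₂ : ℝ
  δ₃ : ℝ
  δ₄ : ℝ

/-- The bounds on `ΔB` and on `Ψ = Ψ₁ + Ψ₂` along a trajectory, for almost all times. `Ψbar` is the
absolutely continuous function `(1/b) (I + ΔB)⁻¹ Ψ₂` whose derivative is bounded. -/
structure PerturbationBounds (M : Model mu mR n) (G : Gains) (D : Bounds) (τ : EReal)
    (X : Trajectory mu mR) (ΔB : ℝ → Matrix (Fin mu ⊕ Fin mR) (Fin mu ⊕ Fin mR) ℝ)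
    (Ψ₁ Ψ₂ Ψbar : ℝ → Out mu mR) : Prop where
  B_eq : ∀ᵐ t ∂(volume.restrict (horizon τ)), M.B X t = (1 + ΔB t) * M.B0
  ΔB_le : ∀ᵐ t ∂(volume.restrict (horizon τ)), ‖op (ΔB t)‖ ≤ D.δB
  Ψ_eq : ∀ᵐ t ∂(volume.restrict (horizon τ)), M.Ψ X t = Ψ₁ t + Ψ₂ t
  Ψ₁_le : ∀ᵐ t ∂(volume.restrict (horizon τ)),
    ‖Ψ₁ t‖ ≤ D.δ₁ * ‖M.σ X t‖ ^ (1 / 2 : ℝ) + D.δ₂ * ‖M.σ X t‖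
  Ψbar_eq : ∀ᵐ t ∂(volume.restrict (horizon τ)), Ψbar t = (1 / G.b) • op (1 + ΔB t)⁻¹ (Ψ₂ t)
  Ψbar_ac : ∀ T ∈ horizon τ, AbsolutelyContinuousOnInterval Ψbar 0 T
  Ψbar_deriv_le : ∀ᵐ t ∂(volume.restrict (horizon τ)),
    ‖deriv Ψbar t‖ ≤ D.δ₃ + D.δ₄ * ‖M.σ X t‖

/-- `x = (σ, ν + Ψbar)` is the error trajectory on `[0, τ)` of some solution of the closed loop along
which the bounds with constants `D` hold. -/
def ErrorTrajectory (M : Model mu mR n) (G : Gains) (D : Bounds) (τ : EReal)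
    (x : ℝ → Out mu mR × Out mu mR) : Prop :=
  ∃ (X : Trajectory mu mR) (ΔB : ℝ → Matrix (Fin mu ⊕ Fin mR) (Fin mu ⊕ Fin mR) ℝ)
    (Ψ₁ Ψ₂ Ψbar : ℝ → Out mu mR),
    M.IsSolution G τ X ∧ M.PerturbationBounds G D τ X ΔB Ψ₁ Ψ₂ Ψbar ∧
    ∀ t ∈ horizon τ, x t = (M.σ X t, X.ν t + Ψbar t)

end Model

end Seismicity

end

/-! Integrating the cascade over the output regions gives `σ̇ = Ψ + B Q`. Since `B₀ B₀⁺ = 1`, the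
control and `Ψ₂` enter through the same factor: with `z = σ`, `y = ν + Ψbar`, `κ = k₁ α₁` and `z =
‖z‖ s`, `‖s‖ ≤ 1`, the error system is `ż = (1 + ΔB) v + e₁`, `v = b y - κ √‖z‖ s`, `ẏ = -g s + e₂`,
`g = k₂ α₁² / 2`. At `z = 0` the Filippov inclusion leaves `s` free in the unit ball. The linear
parts of `φ₁`, `φ₂` and the terms with `δ₂`, `δ₄` are of higher order at the origin and are absorbed
into `e₁`, `e₂`, so that `‖e₁‖ ≤ (δ₁ + 1) √‖z‖` and `‖e₂‖ ≤ δ₃ + 1` near `z = 0`.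

The function `lyapunov` is chosen so that its `z`-gradient is `-v`. Hence a matched uncertainty of
norm at most `δB` only weakens `-‖v‖²` to `-(1 - δB) ‖v‖²`. With `p = κ √‖z‖`, `q = b ‖y‖`, `m = b
⟪y, s⟫`, `h = b g / κ²`, the term `-g s` adds `h (p² - 2 q m)`. By `quadratic_form_ge` the total is
negative definite in `(p, q)` once `2 h < 1 - δB`, which is exactly the condition on `kbar₁`. The
ratio `h` does not change under `k₁ = l kbar₁`, `k₂ = l² kbar₂`, whereas the relative size of `e₁`,
`e₂` is `O(1 / l)`; a large `l` makes them harmless (`lyapunovDeriv_le`).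

Since `κ² lyapunov` is comparable to `p³ + q³` and its derivative is at most a negative multiple of
`p² + q²`, it satisfies `f' ≤ -c f ^ (2/3)` and reaches zero in finite time
(`eq_zero_of_ae_deriv_le`). Solutions are only absolutely continuous, so all of this is done almost
everywhere and integrated. -/

noncomputable section

namespace Seismicity

/-! ### The Lyapunov function and its decay -/

section Lyapunov

variable {E : Type*} [NormedAddCommGroup E] [InnerProductSpace ℝ E]

/-- Lyapunov function of the homogeneous part of the error dynamics. It is the sum of a multiple of
`‖z‖ ^ (3/2)`, of twice the Legendre conjugate of this multiple at `b • y`, and of the pairing. -/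
def lyapunov (κ b : ℝ) (z y : E) : ℝ :=
  2 / 3 * κ * ‖z‖ ^ (3 / 2 : ℝ) - b * inner ℝ y z + 2 * b ^ 3 / (3 * κ ^ 2) * ‖y‖ ^ (3 : ℝ)

/-- The derivative of `lyapunov` at `(z, y)` in direction `(z', y')`. -/
def lyapunovDeriv (κ b : ℝ) (z y z' y' : E) : ℝ :=
  κ * ‖z‖ ^ (-(1 / 2) : ℝ) * inner ℝ z z' - b * (inner ℝ y z' + inner ℝ y' z) +
    2 * b ^ 3 / κ ^ 2 * ‖y‖ * inner ℝ y y'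

theorem hasDerivAt_lyapunov {κ b : ℝ} {z y : ℝ → E} {z' y' : E} {t : ℝ}
    (hz : HasDerivAt z z' t) (hy : HasDerivAt y y' t) :
    HasDerivAt (fun s => lyapunov κ b (z s) (y s)) (lyapunovDeriv κ b (z t) (y t) z' y') t := by
  have h1 := (hasFDerivAt_norm_rpow (z t) (p := 3 / 2) (by norm_num)).comp_hasDerivAt t hz
  have h2 := (hasFDerivAt_norm_rpow (y t) (p := 3) (by norm_num)).comp_hasDerivAt t hy
  have h3 := hy.inner ℝ hz
  have h := ((h1.const_mul (2 / 3 * κ)).sub (h3.const_mul b)).add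
    (h2.const_mul (2 * b ^ 3 / (3 * κ ^ 2)))
  refine h.congr_deriv ?_
  simp only [lyapunovDeriv, FunLike.coe_smul, Pi.smul_apply, innerSL_apply_apply,
    smul_eq_mul]
  norm_num
  by_cases hκ : κ = 0
  · simp [hκ]
  · field_simp

theorem contDiff_lyapunov (κ b : ℝ) :
    ContDiff ℝ 1 (fun x : E × E => lyapunov κ b x.1 x.2) := by
  unfold lyapunov
  have h1 : ContDiff ℝ 1 (fun x : E × E => ‖x.1‖ ^ (3 / 2 : ℝ)) :=
    contDiff_fst.norm_rpow (by norm_num)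
  have h2 : ContDiff ℝ 1 (fun x : E × E => ‖x.2‖ ^ (3 : ℝ)) :=
    contDiff_snd.norm_rpow (by norm_num)
  exact ((contDiff_const.mul h1).sub (contDiff_const.mul (contDiff_snd.inner ℝ contDiff_fst))).add
    (contDiff_const.mul h2)

/-- Young's inequality `q p² ≤ 2/3 p³ + 1/3 q³` already makes the form nonnegative with coefficient
`1/3` at `q³`; the doubled conjugate term supplies the margin. -/
theorem cube_form_nonneg {p q : ℝ} (hp : 0 ≤ p) (hq : 0 ≤ q) :
    (p ^ 3 + q ^ 3) / 10 ≤ 2 / 3 * p ^ 3 - q * p ^ 2 + 2 / 3 * q ^ 3 := by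
  nlinarith [mul_nonneg hp (sq_nonneg (p - q)), mul_nonneg hq (sq_nonneg (p - q)),
    mul_nonneg hp (sq_nonneg (3 * p - 4 * q)), mul_nonneg hq (sq_nonneg (3 * p - 4 * q)),
    mul_nonneg hp (sq_nonneg (2 * p - 3 * q)), mul_nonneg hq (sq_nonneg (2 * p - 3 * q))]

theorem rpow_three_halves {x : ℝ} (hx : 0 ≤ x) : x ^ (3 / 2 : ℝ) = √x ^ 3 := by
  rw [Real.sqrt_eq_rpow, ← Real.rpow_natCast, ← Real.rpow_mul hx]; norm_num

/-- In the variables `p = κ √‖z‖`, `q = b ‖y‖` the function becomes a homogeneous cubic, up to the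
pairing, which is at most `q p²` in absolute value. -/
theorem sq_mul_lyapunov {κ b : ℝ} (hκ : 0 < κ) (z y : E) :
    κ ^ 2 * lyapunov κ b z y = 2 / 3 * (κ * √‖z‖) ^ 3 - κ ^ 2 * (b * inner ℝ y z) +
      2 / 3 * (b * ‖y‖) ^ 3 := by
  rw [lyapunov, rpow_three_halves (norm_nonneg z), show (3 : ℝ) = ((3 : ℕ) : ℝ) by norm_num,
    Real.rpow_natCast]
  push_cast
  field_simp

theorem abs_pairing_le {κ b : ℝ} (hb : 0 ≤ b) (z y : E) :
    |κ ^ 2 * (b * inner ℝ y z)| ≤ b * ‖y‖ * (κ * √‖z‖) ^ 2 := by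
  rw [mul_pow, Real.sq_sqrt (norm_nonneg z), abs_mul, abs_mul, abs_of_nonneg hb,
    abs_of_nonneg (sq_nonneg κ)]
  have := mul_le_mul_of_nonneg_left (abs_real_inner_le_norm y z)
    (mul_nonneg (sq_nonneg κ) hb)
  linarith

theorem le_lyapunov {κ b : ℝ} (hκ : 0 < κ) (hb : 0 ≤ b) (z y : E) :
    ((κ * √‖z‖) ^ 3 + (b * ‖y‖) ^ 3) / 10 ≤ κ ^ 2 * lyapunov κ b z y := by
  rw [sq_mul_lyapunov hκ]
  have h1 := cube_form_nonneg (p := κ * √‖z‖) (q := b * ‖y‖) (by positivity) (by positivity)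
  have h2 := (abs_le.1 (abs_pairing_le (κ := κ) hb z y)).2
  linarith

theorem lyapunov_nonneg {κ b : ℝ} (hκ : 0 < κ) (hb : 0 ≤ b) (z y : E) :
    0 ≤ lyapunov κ b z y := by
  have h := le_lyapunov hκ hb z y
  have h0 : 0 ≤ ((κ * √‖z‖) ^ 3 + (b * ‖y‖) ^ 3) / 10 := by positivity
  exact nonneg_of_mul_nonneg_right (h0.trans h) (by positivity)

theorem lyapunov_le {κ b : ℝ} (hκ : 0 < κ) (hb : 0 ≤ b) (z y : E) :
    κ ^ 2 * lyapunov κ b z y ≤ (κ * √‖z‖ + b * ‖y‖) ^ 3 := by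
  rw [sq_mul_lyapunov hκ]
  have h2 := (abs_le.1 (abs_pairing_le (κ := κ) hb z y)).1
  have hp : 0 ≤ κ * √‖z‖ := by positivity
  have hq : 0 ≤ b * ‖y‖ := by positivity
  generalize κ * √‖z‖ = p at *
  generalize b * ‖y‖ = q at *
  nlinarith [pow_nonneg hp 3, pow_nonneg hq 3, mul_nonneg hp (sq_nonneg q),
    mul_nonneg hq (sq_nonneg p)]

theorem lyapunov_zero (κ b : ℝ) : lyapunov κ b (0 : E) 0 = 0 := by
  simp [lyapunov]

/-- The right-hand side is affine in `m`, so it suffices to check `m = q` and `m = -q`. For `ε = 0`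
the value at `m = q` is the degenerate square `(2 q - p)²`; the margin `ε` is what makes the form
definite. -/
theorem quadratic_form_ge {ε p q m : ℝ} (hε : 0 < ε) (hε1 : ε ≤ 1) (hp : 0 ≤ p)
    (hm : |m| ≤ q) :
    ε / 5 * (p ^ 2 + q ^ 2) ≤
      2 * (1 + ε) * (q ^ 2 - 2 * p * m + p ^ 2) - p ^ 2 + 2 * q * m := by
  obtain ⟨h1, h2⟩ := abs_le.1 hm
  have hq : 0 ≤ q := (abs_nonneg m).trans hm
  -- The value at `m = q`.
  have hpos : ε / 5 * (p ^ 2 + q ^ 2) ≤ (2 * q - p) ^ 2 + 2 * ε * (q - p) ^ 2 := by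
    nlinarith [mul_nonneg hε.le (sq_nonneg (3 * q - 2 * p)),
      mul_nonneg (sub_nonneg.2 hε1) (sq_nonneg (2 * q - p)), mul_nonneg hε.le (sq_nonneg (q - p))]
  -- The value at `m = -q`.
  have hneg : ε / 5 * (p ^ 2 + q ^ 2) ≤ 4 * p * q + p ^ 2 + 2 * ε * (p + q) ^ 2 := by
    nlinarith [mul_nonneg hp hq, mul_nonneg hε.le (mul_nonneg hp hq), sq_nonneg p,
      mul_nonneg hε.le (sq_nonneg p), mul_nonneg hε.le (sq_nonneg q)]
  rcases hq.eq_or_lt with h0 | h0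
  · subst h0
    have : m = 0 := by linarith
    subst this
    nlinarith [mul_nonneg hε.le (sq_nonneg p)]
  -- Interpolation: `2 q` times the value at `m` is `q + m` times the value at `q` plus `q - m`
  -- times the value at `-q`.
  · refine le_of_mul_le_mul_left ?_ (mul_pos two_pos h0)
    nlinarith [mul_le_mul_of_nonneg_left hpos (by linarith : 0 ≤ q + m),
      mul_le_mul_of_nonneg_left hneg (by linarith : 0 ≤ q - m)]

/-- Decay of `lyapunov` along the perturbed homogeneous error dynamics. -/
theorem lyapunovDeriv_le {κ b g δ ε h E₁ E₂ : ℝ} (hκ : 0 < κ) (hb : 0 < b) (hε : 0 < ε)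
    (hε1 : ε ≤ 1) (hh : h = b * g / κ ^ 2) (hg : 0 < g) (hE₁ : 0 ≤ E₁) (hδ : 2 * (1 + ε) * h ≤ 1 - δ)
    (hE : 2 * E₁ / κ + 2 * b * E₂ / κ ^ 2 ≤ h * ε / 10)
    {z y s d e₁ e₂ : E} (hs : ‖s‖ ≤ 1) (hz : ‖z‖ • s = z)
    (hd : ‖d‖ ≤ δ * ‖b • y - (κ * √‖z‖) • s‖) (he₁ : ‖e₁‖ ≤ E₁ * √‖z‖) (he₂ : ‖e₂‖ ≤ E₂) :
    lyapunovDeriv κ b z y (b • y - (κ * √‖z‖) • s + d + e₁) (-(g • s) + e₂) ≤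
      -(h * ε / 10) * ((κ * √‖z‖) ^ 2 + (b * ‖y‖) ^ 2) := by
  set r := ‖z‖ with hr
  have hr0 : 0 ≤ r := norm_nonneg z
  set p := κ * √r with hp
  set q := b * ‖y‖ with hq
  set m := b * inner ℝ y s with hm
  set v := b • y - p • s with hv
  have hp0 : 0 ≤ p := by positivity
  have hq0 : 0 ≤ q := by positivity
  have hE₂ : 0 ≤ E₂ := (norm_nonneg _).trans he₂
  have hh0 : 0 < h := by rw [hh]; positivity
  -- Either `z ≠ 0` and `s` is a unit vector, or `p = 0`; so the freedom of `s` at `z = 0` does no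
  -- harm here.
  have hps : p ^ 2 * ‖s‖ ^ 2 = p ^ 2 := by
    rcases hr0.eq_or_lt with h0 | h0
    · simp [hp, ← h0]
    · have : ‖r • s‖ = r := by rw [hz]
      rw [norm_smul, Real.norm_of_nonneg hr0] at this
      have : ‖s‖ = 1 := by
        apply mul_left_cancel₀ h0.ne'; linarith
      simp [this]
  have hp2 : p ^ 2 = κ ^ 2 * r := by rw [hp, mul_pow, Real.sq_sqrt hr0]
  have hvm : ‖v‖ ^ 2 = q ^ 2 - 2 * p * m + p ^ 2 := by
    rw [hv, norm_sub_sq_real, norm_smul, norm_smul, inner_smul_left, inner_smul_right, mul_pow,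
      mul_pow, Real.norm_eq_abs, sq_abs, Real.norm_eq_abs, sq_abs, hps, hq, hm]
    simp; ring
  have hmq : |m| ≤ q := by
    rw [hm, abs_mul, abs_of_pos hb]
    refine mul_le_mul_of_nonneg_left ?_ hb.le
    refine (abs_real_inner_le_norm y s).trans ?_
    exact mul_le_of_le_one_right (norm_nonneg y) hs
  have hvle : ‖v‖ ≤ q + p := by
    refine (norm_sub_le _ _).trans ?_
    rw [norm_smul, norm_smul, Real.norm_of_nonneg hb.le, Real.norm_of_nonneg hp0]
    gcongr
    exact mul_le_of_le_one_right hp0 hs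
  have hzr (x : E) : κ * r ^ (-(1 / 2) : ℝ) * inner ℝ z x = p * inner ℝ s x := by
    rcases hr0.eq_or_lt with h0 | h0
    · have : z = 0 := by rw [← norm_eq_zero, ← hr, h0]
      simp [this, hp, ← h0]
    · rw [← hz, inner_smul_left, hp, Real.sqrt_eq_rpow]
      simp only [conj_trivial]
      rw [show (1 / 2 : ℝ) = -(1 / 2) + 1 by norm_num, Real.rpow_add h0, Real.rpow_one]
      norm_num
      ring
  -- The `z`-gradient of `lyapunov` is `p • s - b • y = -v`, which produces the first three terms;
  -- the others come from `y' = -(g • s) + e₂`.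
  have key : lyapunovDeriv κ b z y (v + d + e₁) (-(g • s) + e₂) =
      -‖v‖ ^ 2 - inner ℝ v d - inner ℝ v e₁ + b * g * (r * ‖s‖ ^ 2) - b * r * inner ℝ s e₂
        - 2 * h * q * m + 2 * b ^ 2 / κ ^ 2 * q * inner ℝ y e₂ := by
    rw [lyapunovDeriv, ← hr, hzr]
    have e1 : p * inner ℝ s (v + d + e₁) - b * inner ℝ y (v + d + e₁) =
        -‖v‖ ^ 2 - inner ℝ v d - inner ℝ v e₁ := by
      have : p * inner ℝ s (v + d + e₁) - b * inner ℝ y (v + d + e₁) =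
          - inner ℝ v (v + d + e₁) := by
        conv_rhs => rw [hv, inner_sub_left, inner_smul_left, inner_smul_left]
        simp [hv]
      rw [this, inner_add_right, inner_add_right, real_inner_self_eq_norm_sq]; ring
    have e2 : inner ℝ (-(g • s) + e₂) z = - (g * (r * ‖s‖ ^ 2)) + r * inner ℝ s e₂ := by
      conv_lhs => rw [← hz]
      rw [inner_smul_right, inner_add_left, inner_neg_left, inner_smul_left,
        real_inner_self_eq_norm_sq, real_inner_comm]
      simp; ring
    rw [mul_add, e2, inner_add_right y (-(g • s)), inner_neg_right, inner_smul_right, hh, hq, hm]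
    linear_combination e1
  rw [key]
  have i1 : - inner ℝ v d ≤ δ * ‖v‖ ^ 2 := by
    have := (abs_le.1 (abs_real_inner_le_norm v d)).1
    nlinarith [mul_le_mul_of_nonneg_left hd (norm_nonneg v)]
  have i2 : - inner ℝ v e₁ ≤ 2 * E₁ / κ * (p ^ 2 + q ^ 2) := by
    have h1 := (abs_le.1 (abs_real_inner_le_norm v e₁)).1
    have h2 : ‖e₁‖ ≤ E₁ / κ * p := by
      rw [hp]; refine he₁.trans (le_of_eq ?_); field_simp
    have h3 : 0 ≤ E₁ / κ := by positivity
    have h4 : ‖v‖ * ‖e₁‖ ≤ (q + p) * (E₁ / κ * p) :=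
      mul_le_mul hvle h2 (norm_nonneg _) (by positivity)
    have h5 : (q + p) * p ≤ 2 * (p ^ 2 + q ^ 2) := by
      nlinarith [sq_nonneg (p - q), sq_nonneg p, sq_nonneg q]
    have h6 := mul_le_mul_of_nonneg_left h5 h3
    calc -inner ℝ v e₁ ≤ (q + p) * (E₁ / κ * p) := by linarith
      _ = E₁ / κ * ((q + p) * p) := by ring
      _ ≤ E₁ / κ * (2 * (p ^ 2 + q ^ 2)) := h6
      _ = _ := by ring
  have i3 : b * g * (r * ‖s‖ ^ 2) = h * p ^ 2 := by
    rw [← hps, hp2, hh]; field_simp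
  have i4 : - (b * r * inner ℝ s e₂) ≤ b * E₂ / κ ^ 2 * p ^ 2 := by
    have h1 := (abs_le.1 (abs_real_inner_le_norm s e₂)).1
    have h2 : ‖s‖ * ‖e₂‖ ≤ 1 * E₂ := mul_le_mul hs he₂ (norm_nonneg _) zero_le_one
    have h3 : b * r * (-inner ℝ s e₂) ≤ b * r * E₂ :=
      mul_le_mul_of_nonneg_left (by linarith) (by positivity)
    have h4 : b * E₂ / κ ^ 2 * p ^ 2 = b * r * E₂ := by rw [hp2]; field_simp
    linarith
  have i5 : 2 * b ^ 2 / κ ^ 2 * q * inner ℝ y e₂ ≤ 2 * b * E₂ / κ ^ 2 * q ^ 2 := by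
    have h1 := (abs_le.1 (abs_real_inner_le_norm y e₂)).2
    have h2 : ‖y‖ * ‖e₂‖ ≤ ‖y‖ * E₂ := mul_le_mul_of_nonneg_left he₂ (norm_nonneg _)
    have h3 := mul_le_mul_of_nonneg_left (h1.trans h2)
      (by positivity : 0 ≤ 2 * b ^ 2 / κ ^ 2 * q)
    refine h3.trans (le_of_eq ?_)
    rw [hq]; ring
  have i6 := quadratic_form_ge hε hε1 hp0 hmq
  rw [← hvm] at i6
  have i7 := mul_le_mul_of_nonneg_left i6 hh0.le
  have i8 := mul_le_mul_of_nonneg_right hδ (sq_nonneg ‖v‖)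
  have i9 := mul_le_mul_of_nonneg_right hE (by positivity : 0 ≤ p ^ 2 + q ^ 2)
  have i10 : b * E₂ / κ ^ 2 * p ^ 2 ≤ 2 * b * E₂ / κ ^ 2 * p ^ 2 := by
    have : 0 ≤ b * E₂ / κ ^ 2 * p ^ 2 := by positivity
    linarith [show 2 * b * E₂ / κ ^ 2 * p ^ 2 = 2 * (b * E₂ / κ ^ 2 * p ^ 2) by ring]
  rw [i3]
  -- Because `2 (1 + ε) h ≤ 1 - δ`, the quadratic form scaled by `h` yields decay at rate `h ε / 5`;
  -- by `hE` the errors consume at most half of it.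
  linear_combination i1 + i2 + i4 + i5 + i7 + i8 + i9 + i10

end Lyapunov

/-! ### Absolutely continuous functions and differential inequalities -/

section AbsoluteContinuity

open scoped NNReal

theorem _root_.AbsolutelyContinuousOnInterval.congr {X : Type*} [PseudoMetricSpace X] {f g : ℝ → X}
    {a b : ℝ} (hf : AbsolutelyContinuousOnInterval f a b) (h : EqOn f g (uIcc a b)) :
    AbsolutelyContinuousOnInterval g a b := by
  rw [absolutelyContinuousOnInterval_iff] at hf ⊢
  intro ε hε
  obtain ⟨δ, hδ, H⟩ := hf ε hε
  refine ⟨δ, hδ, fun I hI hlt => ?_⟩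
  convert! H I hI hlt using 1
  refine Finset.sum_congr rfl fun i hi => ?_
  rw [h (hI.1 i hi).1, h (hI.1 i hi).2]

theorem _root_.LipschitzOnWith.comp_absolutelyContinuousOnInterval {X Y : Type*}
    [PseudoMetricSpace X] [PseudoMetricSpace Y] {φ : X → Y} {S : Set X} {K : ℝ≥0}
    (hφ : LipschitzOnWith K φ S) {f : ℝ → X} {a b : ℝ}
    (hf : AbsolutelyContinuousOnInterval f a b) (hS : MapsTo f (uIcc a b) S) :
    AbsolutelyContinuousOnInterval (fun t => φ (f t)) a b := by
  rw [absolutelyContinuousOnInterval_iff] at hf ⊢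
  intro ε hε
  obtain ⟨δ, hδ, H⟩ := hf (ε / (K + 1)) (by positivity)
  refine ⟨δ, hδ, fun I hI hlt => ?_⟩
  have h1 := H I hI hlt
  calc _ ≤ ∑ i ∈ Finset.range I.1, K * dist (f (I.2 i).1) (f (I.2 i).2) :=
        Finset.sum_le_sum fun i hi =>
          hφ.dist_le_mul _ (hS (hI.1 i hi).1) _ (hS (hI.1 i hi).2)
    _ = K * ∑ i ∈ Finset.range I.1, dist (f (I.2 i).1) (f (I.2 i).2) := by rw [Finset.mul_sum]
    _ ≤ K * (ε / (K + 1)) := by gcongr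
    _ < (K + 1) * (ε / (K + 1)) := by gcongr; linarith
    _ = ε := by field_simp

theorem _root_.AbsolutelyContinuousOnInterval.prodMk {X Y : Type*}
    [PseudoMetricSpace X] [PseudoMetricSpace Y] {f : ℝ → X} {g : ℝ → Y} {a b : ℝ}
    (hf : AbsolutelyContinuousOnInterval f a b) (hg : AbsolutelyContinuousOnInterval g a b) :
    AbsolutelyContinuousOnInterval (fun t => (f t, g t)) a b := by
  refine squeeze_zero (fun _ => Finset.sum_nonneg fun _ _ => dist_nonneg) (fun I => ?_)
    (by simpa using Tendsto.add hf hg)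
  rw [← Finset.sum_add_distrib]
  refine Finset.sum_le_sum fun i _ => ?_
  exact max_le_add_of_nonneg dist_nonneg dist_nonneg

/-- The curve stays in a closed ball, which is compact and convex, and there a `C¹` map is
Lipschitz. -/
theorem _root_.ContDiff.comp_absolutelyContinuousOnInterval {F G : Type*}
    [NormedAddCommGroup F] [NormedSpace ℝ F] [ProperSpace F]
    [NormedAddCommGroup G] [NormedSpace ℝ G]
    {φ : F → G} (hφ : ContDiff ℝ 1 φ) {f : ℝ → F} {a b : ℝ}
    (hf : AbsolutelyContinuousOnInterval f a b) :
    AbsolutelyContinuousOnInterval (fun t => φ (f t)) a b := by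
  obtain ⟨C, hC⟩ := hf.exists_bound
  obtain ⟨K, hK⟩ := (hφ.contDiffOn (s := Metric.closedBall 0 C)).exists_lipschitzOnWith (by decide)
    (convex_closedBall 0 C) (isCompact_closedBall 0 C)
  exact hK.comp_absolutelyContinuousOnInterval hf fun t ht => by simpa using hC t ht

theorem antitoneOn_of_ae_deriv_nonpos {f : ℝ → ℝ} {a b : ℝ}
    (hf : AbsolutelyContinuousOnInterval f a b)
    (hd : ∀ᵐ t, t ∈ Icc a b → deriv f t ≤ 0) : AntitoneOn f (Icc a b) := by
  intro s hs t ht hst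
  have hab : a ≤ b := hs.1.trans hs.2
  have h1 : AbsolutelyContinuousOnInterval f s t := hf.mono (by
    rw [uIcc_of_le hst, uIcc_of_le hab]; exact Icc_subset_Icc hs.1 ht.2)
  have h2 := h1.integral_deriv_eq_sub
  have h3 : ∫ x in s..t, deriv f x ≤ ∫ x in s..t, (0 : ℝ) := by
    refine intervalIntegral.integral_mono_ae_restrict hst h1.intervalIntegrable_deriv (by simp) ?_
    rw [EventuallyLE, ae_restrict_iff' measurableSet_Icc]
    filter_upwards [hd] with x hx hxs
    exact hx ⟨hs.1.trans hxs.1, hxs.2.trans ht.2⟩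
  simp only [intervalIntegral.integral_zero] at h3
  linarith

/-- The sign of the derivative is known only below the level `c`, so the sublevel set must be shown
to be invariant: up to the first time at which an intermediate level `d` is reached, `f` is
nonincreasing and cannot have climbed to `d`. -/
theorem le_initial_of_ae_deriv_nonpos {f : ℝ → ℝ} {c T : ℝ}
    (hf : AbsolutelyContinuousOnInterval f 0 T) (hc : f 0 < c)
    (hd : ∀ᵐ t, t ∈ Icc 0 T → f t < c → deriv f t ≤ 0) {t : ℝ} (ht : t ∈ Icc 0 T) :
    f t ≤ f 0 := by
  have hT : 0 ≤ T := ht.1.trans ht.2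
  by_contra! hlt
  obtain ⟨d, hd0, hd1⟩ := exists_between (lt_min hc hlt)
  have hcont : ContinuousOn f (Icc 0 t) :=
    hf.continuousOn.mono (by rw [uIcc_of_le hT]; exact Icc_subset_Icc_right ht.2)
  have hne : (Icc 0 t ∩ f ⁻¹' Ici d).Nonempty :=
    ⟨t, ⟨ht.1, le_rfl⟩, (hd1.trans_le (min_le_right _ _)).le⟩
  have hclosed : IsClosed (Icc 0 t ∩ f ⁻¹' Ici d) :=
    hcont.preimage_isClosed_of_isClosed isClosed_Icc isClosed_Ici
  have hbdd : BddBelow (Icc 0 t ∩ f ⁻¹' Ici d) := ⟨0, fun x hx => hx.1.1⟩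
  set s := sInf (Icc 0 t ∩ f ⁻¹' Ici d) with hs
  have hmem : s ∈ Icc 0 t ∩ f ⁻¹' Ici d := hclosed.csInf_mem hne hbdd
  have hanti : AntitoneOn f (Icc 0 s) := by
    refine antitoneOn_of_ae_deriv_nonpos (hf.mono ?_) ?_
    · rw [uIcc_of_le hT, uIcc_of_le hmem.1.1]
      exact Icc_subset_Icc_right (hmem.1.2.trans ht.2)
    · filter_upwards [hd, compl_mem_ae_iff.2 (measure_singleton s)] with x hx hxs hx0
      refine hx ⟨hx0.1, hx0.2.trans (hmem.1.2.trans ht.2)⟩ ?_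
      have hxlt : x < s := lt_of_le_of_ne hx0.2 hxs
      have : x ∉ Icc 0 t ∩ f ⁻¹' Ici d := notMem_of_lt_csInf hxlt hbdd
      have : ¬ d ≤ f x := fun h => this ⟨⟨hx0.1, hx0.2.trans hmem.1.2⟩, h⟩
      exact (not_le.1 this).trans (hd1.trans_le (min_le_left _ _))
  have h1 : f s ≤ f 0 := hanti ⟨le_rfl, hmem.1.1⟩ ⟨hmem.1.1, le_rfl⟩ hmem.1.1
  have h2 : d ≤ f s := hmem.2
  linarith

/-- A nonnegative absolutely continuous function with `f' ≤ -μ f ^ (2/3)` vanishes in finite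
time. -/
theorem eq_zero_of_ae_deriv_le {f : ℝ → ℝ} {c μ T : ℝ} (hμ : 0 < μ)
    (hf : AbsolutelyContinuousOnInterval f 0 T) (hf0 : ∀ t, 0 ≤ f t) (hc : f 0 < c)
    (hd : ∀ᵐ t, t ∈ Icc 0 T → f t < c → deriv f t ≤ -μ * f t ^ (2 / 3 : ℝ))
    (hT : 3 * c ^ (1 / 3 : ℝ) / μ ≤ T) : f T = 0 := by
  have hc0 : 0 < c := (hf0 0).trans_lt hc
  have hT0 : 0 < T := lt_of_lt_of_le (by positivity) hT
  have hd' : ∀ᵐ t, t ∈ Icc 0 T → f t < c → deriv f t ≤ 0 := by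
    filter_upwards [hd] with t ht h1 h2
    refine (ht h1 h2).trans ?_
    have := Real.rpow_nonneg (hf0 t) (2 / 3)
    nlinarith
  have hle := fun {t : ℝ} (ht : t ∈ Icc 0 T) => le_initial_of_ae_deriv_nonpos hf hc hd' ht
  have hanti : AntitoneOn f (Icc 0 T) := by
    refine antitoneOn_of_ae_deriv_nonpos hf ?_
    filter_upwards [hd'] with t ht h1
    exact ht h1 ((hle h1).trans_lt hc)
  by_contra hne
  have hpos : 0 < f T := lt_of_le_of_ne (hf0 T) (Ne.symm hne)
  have hlow {t : ℝ} (ht : t ∈ Icc 0 T) : f T ≤ f t := hanti ht ⟨hT0.le, le_rfl⟩ ht.2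
  -- The cube root is not Lipschitz at `0`; arguing by contradiction from `0 < f T` keeps the values
  -- of `f` away from it.
  have hlip : ContDiffOn ℝ 1 (fun x : ℝ => x ^ (1 / 3 : ℝ)) (Icc (f T) (f 0)) := fun x hx =>
    (Real.contDiffAt_rpow_const_of_ne (hpos.trans_le hx.1).ne').contDiffWithinAt
  obtain ⟨K, hK⟩ := hlip.exists_lipschitzOnWith (by decide) (convex_Icc _ _) isCompact_Icc
  have hgac : AbsolutelyContinuousOnInterval (fun t => f t ^ (1 / 3 : ℝ)) 0 T :=
    hK.comp_absolutelyContinuousOnInterval hf fun t ht => by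
      rw [uIcc_of_le hT0.le] at ht; exact ⟨hlow ht, hle ht⟩
  have hlin : AbsolutelyContinuousOnInterval (fun t : ℝ => μ / 3 * t) 0 T :=
    (ContDiff.contDiffOn (by fun_prop)).absolutelyContinuousOnInterval
  -- The inequality `f' ≤ -μ f ^ (2/3)` says that `f ^ (1/3)` decreases at least at rate `μ / 3`;
  -- over a time `3 c ^ (1/3) / μ` it would become negative.
  have hganti : AntitoneOn (fun t => f t ^ (1 / 3 : ℝ) + μ / 3 * t) (Icc 0 T) := by
    refine antitoneOn_of_ae_deriv_nonpos (hgac.fun_add hlin) ?_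
    filter_upwards [hd, hf.ae_differentiableAt] with t ht hdiff h1
    have hft : 0 < f t := hpos.trans_le (hlow h1)
    have hder := (hdiff (by rwa [uIcc_of_le hT0.le])).hasDerivAt.rpow_const (p := 1 / 3)
      (Or.inl hft.ne')
    have hder2 := (hder.add ((hasDerivAt_id t).const_mul (μ / 3)))
    have heq : deriv (fun t => f t ^ (1 / 3 : ℝ) + μ / 3 * t) t = _ := hder2.deriv
    rw [heq]
    have h3 := ht h1 ((hle h1).trans_lt hc)
    have h4 : f t ^ (2 / 3 : ℝ) * f t ^ (1 / 3 - 1 : ℝ) = 1 := by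
      rw [← Real.rpow_add hft]; norm_num
    have h5 := Real.rpow_pos_of_pos hft (1 / 3 - 1)
    nlinarith [mul_le_mul_of_nonneg_right h3 h5.le]
  have h6 := hganti ⟨le_rfl, hT0.le⟩ ⟨hT0.le, le_rfl⟩ hT0.le
  have h7 : f 0 ^ (1 / 3 : ℝ) < c ^ (1 / 3 : ℝ) :=
    Real.rpow_lt_rpow (hf0 0) hc (by norm_num)
  have h8 : c ^ (1 / 3 : ℝ) ≤ μ / 3 * T := by
    rw [div_le_iff₀ hμ] at hT; linarith
  have h9 := Real.rpow_pos_of_pos hpos (1 / 3)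
  simp only [mul_zero, add_zero] at h6
  linarith

end AbsoluteContinuity

/-! ### From Lyapunov decay to finite-time stability -/

section LyapunovAlongTrajectories

variable {E : Type*} [NormedAddCommGroup E] [InnerProductSpace ℝ E]

theorem rpow_lyapunov_le {κ b : ℝ} (hκ : 0 < κ) (hb : 0 ≤ b) (z y : E) :
    (κ ^ 2) ^ (2 / 3 : ℝ) * lyapunov κ b z y ^ (2 / 3 : ℝ) ≤
      2 * ((κ * √‖z‖) ^ 2 + (b * ‖y‖) ^ 2) := by
  rw [← Real.mul_rpow (by positivity) (lyapunov_nonneg hκ hb z y)]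
  have hp : 0 ≤ κ * √‖z‖ := by positivity
  have hq : 0 ≤ b * ‖y‖ := by positivity
  calc (κ ^ 2 * lyapunov κ b z y) ^ (2 / 3 : ℝ) ≤ ((κ * √‖z‖ + b * ‖y‖) ^ 3) ^ (2 / 3 : ℝ) :=
        Real.rpow_le_rpow (mul_nonneg (by positivity) (lyapunov_nonneg hκ hb z y))
          (lyapunov_le hκ hb z y) (by norm_num)
    _ = (κ * √‖z‖ + b * ‖y‖) ^ 2 := by
        rw [← Real.rpow_natCast _ 3, ← Real.rpow_mul (by positivity), ← Real.rpow_natCast _ 2]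
        norm_num
    _ ≤ _ := by nlinarith [sq_nonneg (κ * √‖z‖ - b * ‖y‖)]

/-- Confines a sublevel set to the region `‖z‖ < ρ`, where the decay estimate is available. -/
theorem norm_lt_of_lyapunov_lt {κ b ρ : ℝ} (hκ : 0 < κ) (hb : 0 ≤ b) {z y : E}
    (h : lyapunov κ b z y < κ * √ρ ^ 3 / 10) : ‖z‖ < ρ := by
  have h1 := le_lyapunov hκ hb z y
  have h2 : (κ * √‖z‖) ^ 3 < (κ * √ρ) ^ 3 := by
    have : κ ^ 2 * lyapunov κ b z y < κ ^ 2 * (κ * √ρ ^ 3 / 10) := by gcongr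
    have h3 : 0 ≤ (b * ‖y‖) ^ 3 := by positivity
    nlinarith
  have h3 := lt_of_pow_lt_pow_left₀ 3 (by positivity) h2
  exact lt_of_not_ge fun hle => not_lt.2 (Real.sqrt_le_sqrt hle) (lt_of_mul_lt_mul_left h3 hκ.le)

theorem norm_lt_of_lyapunov_lt' {κ b ρ : ℝ} (hκ : 0 < κ) (hb : 0 < b) {z y : E}
    (h : lyapunov κ b z y < (b * ρ) ^ 3 / (10 * κ ^ 2)) : ‖y‖ < ρ := by
  have h1 := le_lyapunov hκ hb.le z y
  have h2 : (b * ‖y‖) ^ 3 < (b * ρ) ^ 3 := by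
    rw [lt_div_iff₀ (by positivity)] at h
    have h3 : 0 ≤ (κ * √‖z‖) ^ 3 := by positivity
    nlinarith
  exact lt_of_mul_lt_mul_left ((Odd.strictMono_pow (by decide : Odd 3)).lt_iff_lt.1 h2) hb.le

/-- Trajectories with decaying `lyapunov` near the origin. -/
structure DecaysAlong (κ b ρ μ T : ℝ) (z y : ℝ → E) : Prop where
  z_ac : AbsolutelyContinuousOnInterval z 0 T
  y_ac : AbsolutelyContinuousOnInterval y 0 T
  decay : ∀ᵐ t, t ∈ Icc 0 T → ‖z t‖ < ρ → ∃ z' y', HasDerivAt z z' t ∧ HasDerivAt y y' t ∧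
    lyapunovDeriv κ b (z t) (y t) z' y' ≤ -μ * ((κ * √‖z t‖) ^ 2 + (b * ‖y t‖) ^ 2)

variable {κ b ρ μ T : ℝ} {z y : ℝ → E}

theorem DecaysAlong.lyapunov_ac [ProperSpace E] (H : DecaysAlong κ b ρ μ T z y) :
    AbsolutelyContinuousOnInterval (fun t => lyapunov κ b (z t) (y t)) 0 T :=
  (contDiff_lyapunov (E := E) κ b).comp_absolutelyContinuousOnInterval
    (f := fun t => (z t, y t)) (H.z_ac.prodMk H.y_ac)

theorem DecaysAlong.ae_deriv_le (H : DecaysAlong κ b ρ μ T z y) (hκ : 0 < κ) (hb : 0 < b)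
    (hμ : 0 < μ) :
    ∀ᵐ t, t ∈ Icc 0 T → lyapunov κ b (z t) (y t) < κ * √ρ ^ 3 / 10 →
      deriv (fun t => lyapunov κ b (z t) (y t)) t ≤
        -(μ * (κ ^ 2) ^ (2 / 3 : ℝ) / 2) * lyapunov κ b (z t) (y t) ^ (2 / 3 : ℝ) := by
  filter_upwards [H.decay] with t ht h1 h2
  obtain ⟨z', y', hz, hy, hle⟩ := ht h1 (norm_lt_of_lyapunov_lt hκ hb.le h2)
  rw [(hasDerivAt_lyapunov hz hy).deriv]
  have := mul_le_mul_of_nonneg_left (rpow_lyapunov_le hκ hb.le (z t) (y t)) hμ.le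
  linarith

theorem DecaysAlong.lyapunov_le_initial [ProperSpace E] (H : DecaysAlong κ b ρ μ T z y) (hκ : 0 < κ) (hb : 0 < b)
    (hμ : 0 < μ) (hT : 0 ≤ T) (h0 : lyapunov κ b (z 0) (y 0) < κ * √ρ ^ 3 / 10) :
    lyapunov κ b (z T) (y T) ≤ lyapunov κ b (z 0) (y 0) := by
  refine le_initial_of_ae_deriv_nonpos H.lyapunov_ac h0 ?_ ⟨hT, le_rfl⟩
  filter_upwards [H.ae_deriv_le hκ hb hμ] with t ht h1 h2
  refine (ht h1 h2).trans ?_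
  have h3 := Real.rpow_nonneg (lyapunov_nonneg hκ hb.le (z t) (y t)) (2 / 3)
  have h4 : 0 ≤ μ * (κ ^ 2) ^ (2 / 3 : ℝ) / 2 := by positivity
  nlinarith

theorem DecaysAlong.eq_zero [ProperSpace E] (H : DecaysAlong κ b ρ μ T z y) (hκ : 0 < κ) (hb : 0 < b)
    (hμ : 0 < μ) (h0 : lyapunov κ b (z 0) (y 0) < κ * √ρ ^ 3 / 10)
    (hT : 3 * (κ * √ρ ^ 3 / 10) ^ (1 / 3 : ℝ) / (μ * (κ ^ 2) ^ (2 / 3 : ℝ) / 2) ≤ T) :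
    z T = 0 ∧ y T = 0 := by
  have h1 := eq_zero_of_ae_deriv_le (f := fun t => lyapunov κ b (z t) (y t)) (by positivity)
    H.lyapunov_ac (fun t => lyapunov_nonneg hκ hb.le _ _) h0 (H.ae_deriv_le hκ hb hμ) hT
  have h2 := le_lyapunov hκ hb.le (z T) (y T)
  rw [h1, mul_zero] at h2
  have h3 : 0 ≤ (κ * √‖z T‖) ^ 3 := by positivity
  have h4 : 0 ≤ (b * ‖y T‖) ^ 3 := by positivity
  have h5 : (κ * √‖z T‖) ^ 3 = 0 := by linarith
  have h6 : (b * ‖y T‖) ^ 3 = 0 := by linarith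
  simpa [hκ.ne', hb.ne'] using And.intro h5 h6

/-- A family of trajectories along which `lyapunov` decays near the origin is locally finite-time
stable. -/
theorem locallyFiniteTimeStable_of_decaysAlong [ProperSpace E] (hκ : 0 < κ) (hb : 0 < b) (hρ : 0 < ρ)
    (hμ : 0 < μ) {F : EReal → (ℝ → E × E) → Prop}
    (hF : ∀ τ x, F τ x → ∃ z y : ℝ → E, (∀ t ∈ horizon τ, x t = (z t, y t)) ∧
      ∀ T ∈ horizon τ, 0 < T → DecaysAlong κ b ρ μ T z y) :
    LocallyFiniteTimeStable F := by
  have hsmall (c : ℝ) (hc : 0 < c) :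
      ∃ η : ℝ, 0 < η ∧ ∀ x : E × E, ‖x‖ < η → lyapunov κ b x.1 x.2 < c := by
    have h1 := (contDiff_lyapunov (E := E) κ b).continuous.tendsto 0
    simp only [Prod.fst_zero, Prod.snd_zero, lyapunov_zero] at h1
    obtain ⟨η, hη, h⟩ := Metric.eventually_nhds_iff.1 (h1.eventually (gt_mem_nhds hc))
    exact ⟨η, hη, fun x hx => h (by simpa using hx)⟩
  have hc0 : 0 < κ * √ρ ^ 3 / 10 := by positivity
  have hzero {τ : EReal} {t : ℝ} (ht : t ∈ horizon τ) : (0 : ℝ) ∈ horizon τ :=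
    ⟨le_rfl, lt_of_le_of_lt (by exact_mod_cast ht.1) ht.2⟩
  refine ⟨fun ε hε => ?_, ?_⟩
  -- The three levels guarantee, in order, validity of the decay estimate, `‖z‖ < ε` and `‖y‖ < ε`.
  · obtain ⟨η, hη, h⟩ := hsmall (min (κ * √ρ ^ 3 / 10)
      (min (κ * √ε ^ 3 / 10) ((b * ε) ^ 3 / (10 * κ ^ 2)))) (by positivity)
    refine ⟨η, hη, fun τ x hx hx0 t ht => ?_⟩
    obtain ⟨z, y, hxy, hD⟩ := hF τ x hx
    have h0 := h _ hx0
    rw [hxy 0 (hzero ht)] at h0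
    have h0' := lt_min_iff.1 h0
    have h1 : lyapunov κ b (z t) (y t) ≤ lyapunov κ b (z 0) (y 0) := by
      rcases ht.1.eq_or_lt with h | h
      · rw [← h]
      · exact (hD t ht h).lyapunov_le_initial hκ hb hμ ht.1 h0'.1
    have h2 := lt_min_iff.1 (h1.trans_lt h0'.2)
    rw [hxy t ht, Prod.norm_def]
    exact max_lt (norm_lt_of_lyapunov_lt hκ hb.le h2.1)
      (norm_lt_of_lyapunov_lt' hκ hb h2.2)
  · obtain ⟨r, hr, h⟩ := hsmall _ hc0
    have hTs : 0 < 3 * (κ * √ρ ^ 3 / 10) ^ (1 / 3 : ℝ) / (μ * (κ ^ 2) ^ (2 / 3 : ℝ) / 2) := by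
      positivity
    refine ⟨r, hr, _, hTs, fun τ x hx hx0 t ht hle => ?_⟩
    obtain ⟨z, y, hxy, hD⟩ := hF τ x hx
    have h0 := h _ hx0
    rw [hxy 0 (hzero ht)] at h0
    obtain ⟨h1, h2⟩ := (hD t ht (hTs.trans_le hle)).eq_zero hκ hb hμ h0 hle
    rw [hxy t ht, h1, h2]; rfl

end LyapunovAlongTrajectories

/-! ### The Filippov inclusion for the integral term -/

section Filippov

theorem filippov_subset_closedBall {F : Type*} [NormedAddCommGroup F] [NormedSpace ℝ F]
    [MeasureSpace F] {f : F → F} {x c : F} {r ε : ℝ} (hε : 0 < ε)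
    (h : ∀ y ∈ Metric.ball x ε, ‖f y - c‖ ≤ r) : filippov f x ⊆ Metric.closedBall c r := by
  intro s hs
  simp only [filippov, mem_iInter] at hs
  -- Discarding no null set gives a larger hull, which is enough for an upper bound.
  have h1 := hs ε hε ∅ measure_empty
  refine closure_minimal (convexHull_min ?_ (convex_closedBall c r)) Metric.isClosed_closedBall h1
  rintro _ ⟨y, hy, rfl⟩
  simpa [dist_eq_norm] using h y hy.1

theorem eq_of_mem_filippov {F : Type*} [NormedAddCommGroup F] [NormedSpace ℝ F]
    [MeasureSpace F] {f : F → F} {x s : F} (hf : ContinuousAt f x) (hs : s ∈ filippov f x) :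
    s = f x := by
  refine eq_of_forall_dist_le fun r hr => ?_
  obtain ⟨ε, hε, h⟩ := Metric.continuousAt_iff.1 hf r hr
  exact filippov_subset_closedBall hε (fun y hy => by
    simpa [dist_eq_norm] using (h hy).le) hs

variable {mu mR : ℕ}

/-- Expressed through `s`, the leading part of `φ₁` is `√‖z‖ • s`, with the same `s` that the
Filippov selection of `φ₂` provides, also at `z = 0`. -/
theorem Gains.φ₁_eq (G : Gains) {s z : Out mu mR} (hz : ‖z‖ • s = z) :
    G.φ₁ z = (G.α₁ * √‖z‖) • s + G.α₂ • z := by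
  rcases (norm_nonneg z).eq_or_lt with h | h
  · have : z = 0 := by rw [← norm_eq_zero, h]
    simp [this, Gains.φ₁]
  · rw [Gains.φ₁, add_smul]
    congr 1
    nth_rw 2 [← hz]
    rw [smul_smul, Real.sqrt_eq_rpow, mul_assoc]
    nth_rw 2 [← Real.rpow_one ‖z‖]
    rw [← Real.rpow_add h]; norm_num

theorem Gains.φ₂_eq (G : Gains) {s z : Out mu mR} (hz : ‖z‖ • s = z) (hz0 : z ≠ 0) :
    G.φ₂ z = (G.α₁ ^ 2 / 2 + 3 / 2 * G.α₁ * G.α₂ * √‖z‖ + G.α₂ ^ 2 * ‖z‖) • s := by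
  have h : 0 < ‖z‖ := norm_pos_iff.2 hz0
  rw [Gains.φ₂, G.φ₁_eq hz]
  nth_rw 3 [← hz]
  rw [smul_smul, ← add_smul, smul_smul]
  congr 1
  have : ‖z‖ ^ (-(1 / 2) : ℝ) = (√‖z‖)⁻¹ := by
    rw [Real.rpow_neg h.le, Real.sqrt_eq_rpow]
  rw [this]
  have h2 : √‖z‖ ≠ 0 := (Real.sqrt_pos.2 h).ne'
  have h3 : ‖z‖ = √‖z‖ ^ 2 := (Real.sq_sqrt h.le).symm
  rw [h3, Real.sqrt_sq (Real.sqrt_nonneg _)]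
  field_simp
  ring

theorem norm_smul_inv_norm_smul {F : Type*} [NormedAddCommGroup F] [NormedSpace ℝ F] (z : F) :
    ‖z‖ • (‖z‖⁻¹ • z) = z := by
  by_cases h : z = 0
  · simp [h]
  · rw [smul_smul, mul_inv_cancel₀ (norm_ne_zero_iff.2 h), one_smul]

theorem norm_inv_norm_smul_le {F : Type*} [NormedAddCommGroup F] [NormedSpace ℝ F] (z : F) :
    ‖‖z‖⁻¹ • z‖ ≤ 1 := by
  rw [norm_smul, norm_inv, norm_norm]
  exact inv_mul_le_one

theorem Gains.continuousAt_φ₂ (G : Gains) {z : Out mu mR} (hz : z ≠ 0) :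
    ContinuousAt (G.φ₂ (mu := mu) (mR := mR)) z := by
  have h : ContinuousAt (fun z : Out mu mR => ‖z‖ ^ (-(1 / 2) : ℝ)) z :=
    continuousAt_id.norm.rpow_const (Or.inl (norm_ne_zero_iff.2 hz))
  unfold Gains.φ₂ Gains.φ₁
  fun_prop

/-- The Filippov regularization of `φ₂` is `φ₂` with the unit vector `z / ‖z‖` in it replaced by an
arbitrary vector of the unit ball at `z = 0`. -/
theorem Gains.exists_of_mem_filippov_φ₂ (G : Gains) (hα₁ : 0 < G.α₁) (hα₂ : 0 < G.α₂)
    {z w : Out mu mR} (hw : w ∈ filippov (G.φ₂ (mu := mu) (mR := mR)) z) :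
    ∃ s : Out mu mR, ‖s‖ ≤ 1 ∧ ‖z‖ • s = z ∧
      w = (G.α₁ ^ 2 / 2 + 3 / 2 * G.α₁ * G.α₂ * √‖z‖ + G.α₂ ^ 2 * ‖z‖) • s := by
  by_cases hz : z = 0
  · subst hz
    have hc : 0 < G.α₁ ^ 2 / 2 := by positivity
    have hnorm : ‖w‖ ≤ G.α₁ ^ 2 / 2 := by
      refine le_of_forall_pos_le_add fun r hr => ?_
      have hcont : Tendsto (fun y : Out mu mR => 3 / 2 * G.α₁ * G.α₂ * √‖y‖ + G.α₂ ^ 2 * ‖y‖)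
          (𝓝 0) (𝓝 0) := by
        have : Continuous (fun y : Out mu mR => 3 / 2 * G.α₁ * G.α₂ * √‖y‖ + G.α₂ ^ 2 * ‖y‖) := by
          fun_prop
        simpa using this.tendsto 0
      obtain ⟨ε, hε, h⟩ := Metric.eventually_nhds_iff.1 (hcont.eventually (gt_mem_nhds hr))
      have := filippov_subset_closedBall (f := G.φ₂ (mu := mu) (mR := mR)) (x := 0) (c := 0)
        (r := G.α₁ ^ 2 / 2 + r) hε (fun y hy => ?_) hw
      · simpa using this
      · by_cases hy0 : y = 0
        · subst hy0
          simp only [Gains.φ₂, Gains.φ₁, smul_zero, sub_zero, norm_zero]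
          positivity
        · rw [sub_zero, G.φ₂_eq (norm_smul_inv_norm_smul y) hy0, norm_smul,
            Real.norm_of_nonneg (by positivity)]
          refine (mul_le_of_le_one_right (by positivity) (norm_inv_norm_smul_le y)).trans ?_
          have := h (y := y) (by simpa using hy)
          linarith
    -- Near the origin `‖φ₂‖` exceeds the jump height `α₁² / 2` by arbitrarily little, so the
    -- rescaled `w` lies in the unit ball.
    refine ⟨(G.α₁ ^ 2 / 2)⁻¹ • w, ?_, by simp, ?_⟩
    · rw [norm_smul, norm_inv, Real.norm_of_nonneg hc.le]
      exact inv_mul_le_one_of_le₀ hnorm hc.le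
    · simp only [norm_zero, Real.sqrt_zero, mul_zero, add_zero]
      rw [smul_smul, mul_inv_cancel₀ hc.ne', one_smul]
  · refine ⟨‖z‖⁻¹ • z, norm_inv_norm_smul_le z, norm_smul_inv_norm_smul z, ?_⟩
    rw [eq_of_mem_filippov (G.continuousAt_φ₂ hz) hw, G.φ₂_eq (norm_smul_inv_norm_smul z) hz]

end Filippov

/-! ### Vector-valued curves and time derivatives of space integrals -/

section Curves

theorem _root_.AbsolutelyContinuousOnInterval.euclidean {ι : Type*} [Fintype ι] {f : ι → ℝ → ℝ}
    {a b : ℝ} (hf : ∀ i, AbsolutelyContinuousOnInterval (f i) a b) :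
    AbsolutelyContinuousOnInterval
      (fun t => (WithLp.toLp 2 (fun i => f i t) : EuclideanSpace ℝ ι)) a b := by
  have h : AbsolutelyContinuousOnInterval (fun t i => f i t) a b := by
    refine squeeze_zero (fun _ => Finset.sum_nonneg fun _ _ => dist_nonneg) (fun I => ?_)
      (by simpa using tendsto_finsetSum Finset.univ fun i _ => hf i)
    rw [Finset.sum_comm]
    refine Finset.sum_le_sum fun k _ => ?_
    refine (dist_pi_le_iff (Finset.sum_nonneg fun _ _ => dist_nonneg)).2 fun i => ?_
    exact Finset.single_le_sum
      (f := fun i => dist (f i (I.2 k).1) (f i (I.2 k).2)) (fun _ _ => dist_nonneg)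
      (Finset.mem_univ i)
  exact (PiLp.contDiff_toLp (p := 2) (𝕜 := ℝ) (n := 1)).comp_absolutelyContinuousOnInterval h

theorem hasDerivAt_euclidean {ι : Type*} [Fintype ι] {f : ι → ℝ → ℝ} {f' : ι → ℝ} {t : ℝ}
    (hf : ∀ i, HasDerivAt (f i) (f' i) t) :
    HasDerivAt (fun t => (WithLp.toLp 2 (fun i => f i t) : EuclideanSpace ℝ ι))
      (WithLp.toLp 2 f') t :=
  (PiLp.continuousLinearEquiv 2 ℝ (fun _ : ι => ℝ)).symm.hasFDerivAt.comp_hasDerivAt t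
    (hasDerivAt_pi.2 hf)

theorem BoundedWithTwoDerivatives.apply_ac {ι : Type*} [Fintype ι]
    {r : ℝ → EuclideanSpace ℝ ι} (hr : BoundedWithTwoDerivatives r) (i : ι) {T : ℝ} (hT : 0 ≤ T) :
    AbsolutelyContinuousOnInterval (fun t => r t i) 0 T := by
  obtain ⟨h1, -, L, L', L'', hL⟩ := hr
  have h2 : LipschitzOnWith L'.toNNReal r (Ici 0) := by
    refine (convex_Ici 0).lipschitzOnWith_of_nnnorm_derivWithin_le h1 fun t ht => ?_
    rw [← NNReal.coe_le_coe, coe_nnnorm]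
    exact (hL t ht).2.1.trans (Real.le_coe_toNNReal _)
  have h3 : AbsolutelyContinuousOnInterval r 0 T :=
    (h2.mono (by rw [uIcc_of_le hT]; exact Icc_subset_Ici_self)).absolutelyContinuousOnInterval
  exact (EuclideanSpace.proj (𝕜 := ℝ) i).contDiff.comp_absolutelyContinuousOnInterval h3

theorem BoundedWithTwoDerivatives.hasDerivAt_apply {ι : Type*} [Fintype ι]
    {r : ℝ → EuclideanSpace ℝ ι} (hr : BoundedWithTwoDerivatives r) (i : ι) {t : ℝ} (ht : 0 < t) :
    HasDerivAt (fun t => r t i) (dot r t i) t :=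
  (EuclideanSpace.proj (𝕜 := ℝ) i).hasFDerivAt.comp_hasDerivAt t
    ((hr.1 t ht.le).hasDerivWithinAt.hasDerivAt (Ici_mem_nhds ht))

/-- Space integrals of a function that is the time integral of an integrable function. -/
theorem integral_ac_and_hasDerivAt {X : Type*} [MeasurableSpace X] {ν : Measure X} [SFinite ν]
    {f f' : ℝ → X → ℝ} {T t₀ : ℝ}
    (hf' : Integrable (Function.uncurry f') ((volume.restrict (Icc 0 T)).prod ν))
    (ht₀ : t₀ ∈ Icc 0 T) (hf : Integrable (f t₀) ν)
    (h : ∀ t ∈ Icc 0 T, ∀ᵐ x ∂ν, f t x = f 0 x + ∫ s in (0 : ℝ)..t, f' s x) :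
    AbsolutelyContinuousOnInterval (fun t => ∫ x, f t x ∂ν) 0 T ∧
      ∀ᵐ t, t ∈ Icc 0 T → HasDerivAt (fun t => ∫ x, f t x ∂ν) (∫ x, f' t x ∂ν) t := by
  have hT : 0 ≤ T := ht₀.1.trans ht₀.2
  have hint {t : ℝ} (ht : t ∈ Icc 0 T) :
      Integrable (Function.uncurry f') ((volume.restrict (Ioc 0 t)).prod ν) :=
    hf'.mono_measure (Measure.prod_mono (Measure.restrict_mono
      (Ioc_subset_Icc_self.trans (Icc_subset_Icc_right ht.2)) le_rfl) le_rfl)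
  have hintx {t : ℝ} (ht : t ∈ Icc 0 T) :
      Integrable (fun x => ∫ s in (0 : ℝ)..t, f' s x) ν := by
    simp only [intervalIntegral.integral_of_le ht.1]
    exact (hint ht).integral_prod_right
  -- Integrability is given at `t₀` only and is carried back to time `0` by the integral equation.
  have hf0 : Integrable (f 0) ν := by
    refine (hf.sub (hintx ht₀)).congr ?_
    filter_upwards [h t₀ ht₀] with x hx
    simp [hx]
  have hI : IntervalIntegrable (fun s => ∫ x, f' s x ∂ν) volume 0 T := by
    rw [intervalIntegrable_iff_integrableOn_Ioc_of_le hT]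
    exact (hint ⟨hT, le_rfl⟩).integral_prod_left
  have heq : ∀ t ∈ Icc 0 T,
      ∫ x, f t x ∂ν = (∫ x, f 0 x ∂ν) + ∫ s in (0 : ℝ)..t, ∫ x, f' s x ∂ν := by
    intro t ht
    rw [integral_congr_ae (h t ht), integral_add hf0 (hintx ht)]
    simp only [intervalIntegral.integral_of_le ht.1]
    rw [integral_integral_swap (hint ht)]
  have hconst : AbsolutelyContinuousOnInterval (fun _ : ℝ => ∫ x, f 0 x ∂ν) 0 T :=
    (ContDiff.contDiffOn contDiff_const).absolutelyContinuousOnInterval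
  constructor
  · refine (hconst.fun_add
      (hI.absolutelyContinuousOnInterval_intervalIntegral (c := 0) (by simp))).congr ?_
    intro t ht
    rw [uIcc_of_le hT] at ht
    exact (heq t ht).symm
  -- The formula `heq` holds on `[0, T]` only, so the endpoints are removed to get a two-sided
  -- derivative.
  · filter_upwards [hI.ae_hasDerivAt_integral, compl_mem_ae_iff.2 (measure_singleton (0 : ℝ)),
      compl_mem_ae_iff.2 (measure_singleton T)] with t ht h0 h1 htI
    have hd := (ht (by rwa [uIcc_of_le hT]) 0 (by simp)).const_add (∫ x, f 0 x ∂ν)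
    refine hd.congr_of_eventuallyEq ?_
    filter_upwards [Icc_mem_nhds (lt_of_le_of_ne htI.1 (Ne.symm h0)) (lt_of_le_of_ne htI.2 h1)]
      with s hs using heq s hs

end Curves

/-! ### Averaged outputs: from the cascade to the error dynamics -/

theorem horizon_Icc_subset {τ : EReal} {T : ℝ} (hT : T ∈ horizon τ) : Icc 0 T ⊆ horizon τ :=
  fun _ ht => ⟨ht.1, lt_of_le_of_lt (by exact_mod_cast ht.2) hT.2⟩

theorem ae_Icc_of_ae_horizon {τ : EReal} {T : ℝ} (hT : T ∈ horizon τ) {P : ℝ → Prop}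
    (h : ∀ᵐ t ∂(volume.restrict (horizon τ)), P t) : ∀ᵐ t, t ∈ Icc 0 T → P t :=
  (ae_restrict_iff' measurableSet_Icc).1
    (ae_restrict_of_ae_restrict_of_subset (horizon_Icc_subset hT) h)

theorem CoefficientBounds.exists_abs_le {V : Set E3} {γ : ℝ → E3 → ℝ}
    (h : CoefficientBounds V γ) : ∃ C : ℝ, ∀ t x, 0 ≤ t → x ∈ V → |γ t x| ≤ C := by
  obtain ⟨m, C, L, hm, H⟩ := h
  refine ⟨C, fun t x ht hx => ?_⟩
  obtain ⟨h1, h2, -⟩ := (H x hx).2 t ht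
  rwa [abs_of_pos (hm.trans_le h1)]

namespace Model

variable {mu mR n : ℕ} {M : Model mu mR n} {G : Gains} {τ : EReal} {X : Trajectory mu mR} {T : ℝ}

theorem Basic.isFiniteMeasure (hM : M.Basic) : IsFiniteMeasure (volume.restrict M.V) :=
  ⟨by simpa using hM.volume_V.2⟩

theorem Basic.real_pos (hM : M.Basic) {S : Set E3} (hS : S ⊆ M.V) (h0 : 0 < volume S) :
    0 < volume.real S :=
  ENNReal.toReal_pos h0.ne' ((measure_mono hS).trans_lt hM.volume_V.2).ne

/-- The entries of `B(t)` arise here: an input region that is nested in or disjoint from an output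
region contributes its own mean or nothing. -/
theorem Basic.integral_source_mul (hM : M.Basic) (j : Fin n) {S : Set E3}
    (hS : M.Vs j ⊆ S ∨ Disjoint (M.Vs j) S) [Decidable (M.Vs j ⊆ S)] (h : E3 → ℝ) :
    ∫ x in S, M.source j x * h x =
      if M.Vs j ⊆ S then 1 / volume.real (M.Vs j) * ∫ x in M.Vs j, h x else 0 := by
  have h1 : (fun x => M.source j x * h x) =
      (M.Vs j).indicator (fun x => 1 / volume.real (M.Vs j) * h x) := by
    ext x
    by_cases hx : x ∈ M.Vs j <;> simp [source, hx]
  rw [h1, setIntegral_indicator (hM.Vs_region j).1]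
  split_ifs with hj
  · rw [inter_eq_self_of_subset_right hj, integral_const_mul]
  · rw [(hS.resolve_left hj).symm.inter_eq, setIntegral_empty]

theorem Basic.integrable_source_mul (hM : M.Basic) (j : Fin n) {ν : Measure E3} {h : E3 → ℝ}
    (hh : Integrable h ν) : Integrable (fun x => M.source j x * h x) ν := by
  have h1 : (fun x => M.source j x * h x) =
      (M.Vs j).indicator (fun x => 1 / volume.real (M.Vs j) * h x) := by
    ext x
    by_cases hx : x ∈ M.Vs j <;> simp [source, hx]
  rw [h1]
  exact (hh.const_mul _).indicator (hM.Vs_region j).1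

theorem restrict_prod_restrict_Icc_le (V : Set E3) (T : ℝ) :
    (volume.restrict (Icc 0 T)).prod (volume.restrict V) ≤
      (volume.restrict (Ici (0 : ℝ))).prod (volume.restrict V) :=
  Measure.prod_mono (Measure.restrict_mono Icc_subset_Ici_self le_rfl) le_rfl

theorem ae_prod_restrict_mem (hM : M.Basic) (T : ℝ) :
    ∀ᵐ p ∂((volume.restrict (Icc 0 T)).prod (volume.restrict M.V)), p ∈ Icc 0 T ×ˢ M.V := by
  rw [Measure.prod_restrict]
  exact ae_restrict_mem (measurableSet_Icc.prod hM.isOpen_V.measurableSet)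

theorem integrable_coefficient_mul (hM : M.Basic) {γ : ℝ → E3 → ℝ} (hγ : CoefficientBounds M.V γ)
    (hm : AEMeasurable (Function.uncurry γ)
      ((volume.restrict (Ici 0)).prod (volume.restrict M.V))) {f : ℝ × E3 → ℝ}
    (hf : Integrable f ((volume.restrict (Icc 0 T)).prod (volume.restrict M.V))) :
    Integrable (fun p => γ p.1 p.2 * f p)
      ((volume.restrict (Icc 0 T)).prod (volume.restrict M.V)) := by
  obtain ⟨C, hC⟩ := hγ.exists_abs_le
  refine hf.bdd_mul (f := Function.uncurry γ) (c := C)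
    (hm.mono_measure (restrict_prod_restrict_Icc_le _ _)).aestronglyMeasurable ?_
  filter_upwards [ae_prod_restrict_mem hM T] with p hp
  exact hC _ _ hp.1.1 hp.2

/-- For almost all times a coefficient is a bounded multiplier of `L¹(V)`. -/
theorem ae_integrable_coefficient_mul (hM : M.Basic) {γ : ℝ → E3 → ℝ}
    (hγ : CoefficientBounds M.V γ) (hm : AEMeasurable (Function.uncurry γ)
      ((volume.restrict (Ici 0)).prod (volume.restrict M.V))) :
    ∀ᵐ t, t ∈ Icc 0 T → ∀ f : E3 → ℝ, Integrable f (volume.restrict M.V) →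
      Integrable (fun x => γ t x * f x) (volume.restrict M.V) := by
  obtain ⟨C, hC⟩ := hγ.exists_abs_le
  have h1 := (hm.mono_measure (restrict_prod_restrict_Icc_le M.V T)).aestronglyMeasurable.prodMk_left
  filter_upwards [(ae_restrict_iff' measurableSet_Icc).1 h1] with t ht htI f hf
  refine hf.bdd_mul (f := γ t) (c := C) (ht htI) ?_
  filter_upwards [ae_restrict_mem hM.isOpen_V.measurableSet] with x hx
  exact hC _ _ htI.1 hx

theorem IsSolution.integrable_Rt (hX : M.IsSolution G τ X) (hM : M.Admissible)
    (hT : T ∈ horizon τ) : Integrable (Function.uncurry (M.Rt X))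
      ((volume.restrict (Icc 0 T)).prod (volume.restrict M.V)) := by
  have hb := hM.basic
  have := hb.isFiniteMeasure
  have hR := hX.R_memLp T hT
  have hu := hX.ut_memLp T hT
  have hS : MemLp (fun p : ℝ × E3 => M.Rstar p.2) 2
      ((volume.restrict (Icc 0 T)).prod (volume.restrict M.V)) := hb.Rstar_memLp.comp_snd _
  have h1 := integrable_coefficient_mul hb hM.coefficients.γ₁_bdd hb.γ₁_meas (hR.integrable_mul hu)
  have h2 := integrable_coefficient_mul hb hM.coefficients.γ₂_bdd hb.γ₂_meas (hR.integrable_mul hR)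
  have h3 := integrable_coefficient_mul hb hM.coefficients.γ₂_bdd hb.γ₂_meas (hR.integrable_mul hS)
  refine ((h3.sub h1).sub h2).congr (Eventually.of_forall fun p => ?_)
  simp only [Function.uncurry, Rt, Pi.mul_apply, Pi.sub_apply]
  ring

theorem IsSolution.pressure_output (hX : M.IsSolution G τ X) (hM : M.Admissible)
    (hT : T ∈ horizon τ) (i : Fin mu) :
    AbsolutelyContinuousOnInterval (fun t => ∫ x in M.Vu i, X.u t x) 0 T ∧
      ∀ᵐ t, t ∈ Icc 0 T →
        HasDerivAt (fun t => ∫ x in M.Vu i, X.u t x) (∫ x in M.Vu i, X.ut t x) t := by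
  have := hM.basic.isFiniteMeasure
  have hle : volume.restrict (M.Vu i) ≤ volume.restrict M.V :=
    Measure.restrict_mono (hM.basic.Vu_region i).2.1 le_rfl
  have h0 : (0 : ℝ) ∈ Icc 0 T := ⟨le_rfl, hT.1⟩
  refine integral_ac_and_hasDerivAt (t₀ := 0) ?_ h0 ?_ fun t ht => ?_
  · exact ((hX.ut_memLp T hT).integrable (by norm_num)).mono_measure
      (Measure.prod_mono le_rfl hle)
  · exact ((hX.u_H1 0 (horizon_Icc_subset hT h0)).1.integrable (by norm_num)).mono_measure hle
  · exact ae_mono hle (hX.u_eq t (horizon_Icc_subset hT ht))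

/-- Square integrability of `R` in space is known for almost all times only, possibly not at `t =
0`; one good time serves as `t₀` in `integral_ac_and_hasDerivAt`. -/
theorem IsSolution.exists_memLp_R (hX : M.IsSolution G τ X) (hT : T ∈ horizon τ) (hT0 : 0 < T) :
    ∃ t ∈ Icc 0 T, MemLp (X.R t) 2 (volume.restrict M.V) := by
  have h1 := ae_restrict_of_ae_restrict_of_subset (horizon_Icc_subset hT) hX.R_H1
  have h2 : (ae (volume.restrict (Icc 0 T))).NeBot := by
    rw [ae_neBot, Ne, Measure.restrict_eq_zero, Real.volume_Icc]
    simpa using hT0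
  obtain ⟨t, ⟨⟨g, hg⟩, -⟩, ht⟩ := (h1.and (ae_restrict_mem measurableSet_Icc)).exists
  exact ⟨t, ht, hg.1⟩

theorem IsSolution.rate_output (hX : M.IsSolution G τ X) (hM : M.Admissible)
    (hT : T ∈ horizon τ) (hT0 : 0 < T) (i : Fin mR) :
    AbsolutelyContinuousOnInterval (fun t => ∫ x in M.VR i, X.R t x) 0 T ∧
      ∀ᵐ t, t ∈ Icc 0 T →
        HasDerivAt (fun t => ∫ x in M.VR i, X.R t x) (∫ x in M.VR i, M.Rt X t x) t := by
  have := hM.basic.isFiniteMeasure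
  have hle : volume.restrict (M.VR i) ≤ volume.restrict M.V :=
    Measure.restrict_mono (hM.basic.VR_region i).2.1 le_rfl
  obtain ⟨t₀, ht₀, hR⟩ := hX.exists_memLp_R hT hT0
  refine integral_ac_and_hasDerivAt ?_ ht₀ ((hR.integrable (by norm_num)).mono_measure hle)
    fun t ht => ?_
  · exact (hX.integrable_Rt hM hT).mono_measure (Measure.prod_mono le_rfl hle)
  · exact ae_mono hle (hX.R_eq t (horizon_Icc_subset hT ht))

theorem IsSolution.ae_integral_ut (hX : M.IsSolution G τ X) (hM : M.Admissible)
    (hT : T ∈ horizon τ) (i : Fin mu) : ∀ᵐ t, t ∈ Icc 0 T →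
      1 / volume.real (M.Vu i) * ∫ x in M.Vu i, X.ut t x =
        -(1 / (M.β * volume.real (M.Vu i))) * (∫ x in M.Vu i, X.divq t x) +
          (M.B X t).mulVec (M.Q G X t) (Sum.inl i) := by
  classical
  have hb := hM.basic
  have := hb.isFiniteMeasure
  have hle : volume.restrict (M.Vu i) ≤ volume.restrict M.V :=
    Measure.restrict_mono (hb.Vu_region i).2.1 le_rfl
  filter_upwards [ae_Icc_of_ae_horizon hT hX.divq_spec, ae_Icc_of_ae_horizon hT hX.diffusion]
    with t h1 h2 ht
  have hq : Integrable (X.divq t) (volume.restrict (M.Vu i)) :=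
    ((h1 ht).2.1.integrable (by norm_num)).mono_measure hle
  have hs (j : Fin n) : Integrable (fun x => M.source j x * 1) (volume.restrict (M.Vu i)) :=
    hb.integrable_source_mul j ((integrable_const 1).mono_measure hle)
  have hval (j : Fin n) : ∫ x in M.Vu i, M.source j x * 1 = if M.Vs j ⊆ M.Vu i then 1 else 0 := by
    rw [hb.integral_source_mul j (hM.regions.inside_or_outside_Vu j i)]
    have := hb.real_pos (hb.Vs_region j).2.1 (hb.Vs_region j).2.2
    simp [this.ne']
  have hint : ∫ x in M.Vu i, X.ut t x =
      -(1 / M.β) * (∫ x in M.Vu i, X.divq t x) +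
        ∑ j, (1 / M.β * M.Q G X t j) * ∫ x in M.Vu i, M.source j x * 1 := by
    rw [integral_congr_ae (ae_mono hle (h2 ht))]
    have : (fun x => -(1 / M.β) * X.divq t x + 1 / M.β * ∑ j, M.source j x * M.Q G X t j) =
        fun x => -(1 / M.β) * X.divq t x +
          ∑ j, (1 / M.β * M.Q G X t j) * (M.source j x * 1) := by
      ext x
      rw [Finset.mul_sum]
      congr 1
      exact Finset.sum_congr rfl fun j _ => by ring
    rw [this, integral_add (hq.const_mul _) (integrable_finsetSum _ fun j _ => (hs j).const_mul _),
      integral_const_mul, integral_finsetSum _ fun j _ => (hs j).const_mul _]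
    simp only [integral_const_mul]
  rw [hint, mul_add, Finset.mul_sum]
  congr 1
  · field_simp
  · refine Finset.sum_congr rfl fun j _ => ?_
    rw [hval]
    simp only [B, Matrix.of_apply, Sum.elim_inl]
    split_ifs
    · field_simp
    · simp

theorem IsSolution.ae_integral_Rt (hX : M.IsSolution G τ X) (hM : M.Admissible)
    (hT : T ∈ horizon τ) (i : Fin mR) : ∀ᵐ t, t ∈ Icc 0 T →
      1 / (M.γ10 * M.Rstar0) * (1 / volume.real (M.VR i) * ∫ x in M.VR i, M.Rt X t x) =
        1 / (M.γ10 * M.Rstar0 * M.β * volume.real (M.VR i)) *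
            (∫ x in M.VR i, M.γ₁ t x * X.R t x * X.divq t x)
          - 1 / (M.γ10 * M.Rstar0 * volume.real (M.VR i)) *
            (∫ x in M.VR i, M.γ₂ t x * X.R t x ^ 2)
          + 1 / (M.γ10 * M.Rstar0 * volume.real (M.VR i)) *
            (∫ x in M.VR i, M.γ₂ t x * X.R t x * M.Rstar x)
          + (M.B X t).mulVec (M.Q G X t) (Sum.inr i) := by
  classical
  have hb := hM.basic
  have := hb.isFiniteMeasure
  have hle : volume.restrict (M.VR i) ≤ volume.restrict M.V :=
    Measure.restrict_mono (hb.VR_region i).2.1 le_rfl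
  filter_upwards [ae_Icc_of_ae_horizon hT hX.divq_spec, ae_Icc_of_ae_horizon hT hX.diffusion,
    ae_Icc_of_ae_horizon hT hX.R_H1,
    ae_integrable_coefficient_mul (T := T) hb hM.coefficients.γ₁_bdd hb.γ₁_meas,
    ae_integrable_coefficient_mul (T := T) hb hM.coefficients.γ₂_bdd hb.γ₂_meas]
    with t h1 h2 h3 h4 h5 ht
  have hR : MemLp (X.R t) 2 (volume.restrict M.V) := by
    obtain ⟨g, hg⟩ := (h3 ht).1
    exact hg.1
  have hq := (h1 ht).2.1
  have i1 : Integrable (fun x => M.γ₁ t x * X.R t x * X.divq t x) (volume.restrict (M.VR i)) :=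
    ((h4 ht _ (hR.integrable_mul hq)).congr (Eventually.of_forall fun x => by
      simp [mul_assoc])).mono_measure hle
  have i2 : Integrable (fun x => M.γ₂ t x * X.R t x ^ 2) (volume.restrict (M.VR i)) :=
    (h5 ht _ hR.integrable_sq).mono_measure hle
  have i3 : Integrable (fun x => M.γ₂ t x * X.R t x * M.Rstar x) (volume.restrict (M.VR i)) :=
    ((h5 ht _ (hR.integrable_mul hb.Rstar_memLp)).congr (Eventually.of_forall fun x => by
      simp [mul_assoc])).mono_measure hle
  have i4 (j : Fin n) : Integrable (fun x => M.source j x * (M.γ₁ t x * X.R t x))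
      (volume.restrict (M.VR i)) :=
    hb.integrable_source_mul j ((h4 ht _ (hR.integrable (by norm_num))).mono_measure hle)
  have hint : ∫ x in M.VR i, M.Rt X t x =
      1 / M.β * (∫ x in M.VR i, M.γ₁ t x * X.R t x * X.divq t x)
        - (∫ x in M.VR i, M.γ₂ t x * X.R t x ^ 2)
        + (∫ x in M.VR i, M.γ₂ t x * X.R t x * M.Rstar x)
        + ∑ j, (-(1 / M.β) * M.Q G X t j) *
            ∫ x in M.VR i, M.source j x * (M.γ₁ t x * X.R t x) := by
    -- The diffusion equation is inserted for `ut` in the rate equation.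
    have hae : ∀ᵐ x ∂(volume.restrict (M.VR i)), M.Rt X t x =
        1 / M.β * (M.γ₁ t x * X.R t x * X.divq t x) - M.γ₂ t x * X.R t x ^ 2
          + M.γ₂ t x * X.R t x * M.Rstar x
          + ∑ j, (-(1 / M.β) * M.Q G X t j) * (M.source j x * (M.γ₁ t x * X.R t x)) := by
      filter_upwards [ae_mono hle (h2 ht)] with x hx
      rw [Rt, hx]
      have : ∑ j, (-(1 / M.β) * M.Q G X t j) * (M.source j x * (M.γ₁ t x * X.R t x)) =
          -(M.γ₁ t x * X.R t x) * (1 / M.β * ∑ j, M.source j x * M.Q G X t j) := by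
        rw [Finset.mul_sum, Finset.mul_sum]
        exact Finset.sum_congr rfl fun j _ => by ring
      rw [this]
      ring
    have i12 : Integrable (fun x => 1 / M.β * (M.γ₁ t x * X.R t x * X.divq t x) -
        M.γ₂ t x * X.R t x ^ 2) (volume.restrict (M.VR i)) := (i1.const_mul _).sub i2
    have i123 : Integrable (fun x => 1 / M.β * (M.γ₁ t x * X.R t x * X.divq t x) -
        M.γ₂ t x * X.R t x ^ 2 + M.γ₂ t x * X.R t x * M.Rstar x)
        (volume.restrict (M.VR i)) := i12.add i3
    rw [integral_congr_ae hae, integral_add i123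
      (integrable_finsetSum _ fun j _ => (i4 j).const_mul _),
      integral_add i12 i3, integral_sub (i1.const_mul _) i2,
      integral_const_mul, integral_finsetSum _ fun j _ => (i4 j).const_mul _]
    simp only [integral_const_mul]
  rw [hint, mul_add, mul_add, Finset.mul_sum, Finset.mul_sum]
  congr 1
  · field_simp
  · refine Finset.sum_congr rfl fun j _ => ?_
    rw [hb.integral_source_mul j (hM.regions.inside_or_outside_VR j i)]
    simp only [B, Matrix.of_apply, Sum.elim_inr]
    split_ifs
    · field_simp
    · simp

/-- The error dynamics `σ̇ = Ψ + B Q`. -/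
theorem IsSolution.error_dynamics (hX : M.IsSolution G τ X) (hM : M.Admissible)
    (hT : T ∈ horizon τ) (hT0 : 0 < T) :
    AbsolutelyContinuousOnInterval (M.σ X) 0 T ∧ ∀ᵐ t, t ∈ Icc 0 T →
      HasDerivAt (M.σ X) (M.Ψ X t + WithLp.toLp 2 ((M.B X t).mulVec (M.Q G X t))) t := by
  have hu := fun i => hX.pressure_output hM hT i
  have hR := fun i => hX.rate_output hM hT hT0 i
  have hσ : M.σ X = fun t => (WithLp.toLp 2 (fun k => Sum.elim
      (fun i t => 1 / volume.real (M.Vu i) * (∫ x in M.Vu i, X.u t x) - M.ru t i)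
      (fun i t => 1 / (M.γ10 * M.Rstar0) *
        (1 / volume.real (M.VR i) * (∫ x in M.VR i, X.R t x) - M.rR t i)) k t) : Out mu mR) := by
    ext t k
    cases k <;> rfl
  constructor
  · rw [hσ]
    refine AbsolutelyContinuousOnInterval.euclidean fun k => ?_
    cases k with
    | inl i => exact ((hu i).1.const_mul _).fun_sub (hM.references.ru_bdd.apply_ac i hT.1)
    | inr i =>
      exact (((hR i).1.const_mul _).fun_sub (hM.references.rR_bdd.apply_ac i hT.1)).const_mul _
  · filter_upwards [ae_all_iff.2 fun i => (hu i).2, ae_all_iff.2 fun i => (hR i).2,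
      ae_all_iff.2 fun i => hX.ae_integral_ut hM hT i,
      ae_all_iff.2 fun i => hX.ae_integral_Rt hM hT i,
      compl_mem_ae_iff.2 (measure_singleton (0 : ℝ))] with t h1 h2 h3 h4 h0 ht
    have htpos : 0 < t := lt_of_le_of_ne ht.1 (Ne.symm h0)
    have hd := hasDerivAt_euclidean (ι := Fin mu ⊕ Fin mR) (f := Sum.elim
      (fun i t => 1 / volume.real (M.Vu i) * (∫ x in M.Vu i, X.u t x) - M.ru t i)
      (fun i t => 1 / (M.γ10 * M.Rstar0) *
        (1 / volume.real (M.VR i) * (∫ x in M.VR i, X.R t x) - M.rR t i)))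
      (f' := Sum.elim
        (fun i => 1 / volume.real (M.Vu i) * (∫ x in M.Vu i, X.ut t x) - dot M.ru t i)
        (fun i => 1 / (M.γ10 * M.Rstar0) *
          (1 / volume.real (M.VR i) * (∫ x in M.VR i, M.Rt X t x) - dot M.rR t i))) (t := t)
      (fun k => by
        cases k with
        | inl i =>
          exact ((h1 i ht).const_mul _).sub (hM.references.ru_bdd.hasDerivAt_apply i htpos)
        | inr i =>
          exact (((h2 i ht).const_mul _).sub
            (hM.references.rR_bdd.hasDerivAt_apply i htpos)).const_mul _)
    rw [hσ]
    refine hd.congr_deriv ?_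
    ext k
    cases k with
    | inl i =>
      simp only [Sum.elim_inl, PiLp.add_apply, Ψ]
      rw [h3 i ht]; ring
    | inr i =>
      simp only [Sum.elim_inr, PiLp.add_apply, Ψ]
      rw [mul_sub, h4 i ht]; ring

end Model

/-! ### The matched closed loop and decay along its solutions -/

theorem op_toLp_mulVec {ι : Type*} [Fintype ι] [DecidableEq ι] (A : Matrix ι ι ℝ) (w : ι → ℝ) :
    op A (WithLp.toLp 2 w) = WithLp.toLp 2 (A.mulVec w) := by
  simp [op]

theorem op_one_add {ι : Type*} [Fintype ι] [DecidableEq ι] (A : Matrix ι ι ℝ)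
    (x : EuclideanSpace ℝ ι) : op (1 + A) x = x + op A x := by
  simp [op, map_add]

/-- A Neumann series makes `1 + A` invertible, so the matrix inverse is a genuine one. -/
theorem op_one_add_inv {ι : Type*} [Fintype ι] [DecidableEq ι] {A : Matrix ι ι ℝ}
    (hA : ‖op A‖ < 1) (x : EuclideanSpace ℝ ι) : op (1 + A) (op (1 + A)⁻¹ x) = x := by
  have h1 : IsUnit (1 + A) := by
    have h2 : IsUnit (op (1 + A)) := by
      have h3 : op (1 + A) = 1 - (-op A) := by simp [op, map_add]
      rw [h3]
      exact isUnit_one_sub_of_norm_lt_one (by rwa [norm_neg])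
    exact (isUnit_map_iff (Matrix.toEuclideanCLM (n := ι) (𝕜 := ℝ)) _).1 h2
  have h2 : op (1 + A) * op (1 + A)⁻¹ = 1 := by
    rw [← map_mul, Matrix.mul_nonsing_inv _ ((Matrix.isUnit_iff_isUnit_det _).1 h1), map_one]
  exact congrArg (fun F => F x) h2

namespace Model

variable {mu mR n : ℕ} {M : Model mu mR n} {G : Gains} {τ : EReal} {X : Trajectory mu mR} {T : ℝ}

/-- The kernel of `B₀ B₀ᵀ` is that of `B₀ᵀ`, which is trivial because the rows of `B₀` are
independent. -/
theorem B0_mul_B0pinv (hM : M.RegionAssumption) : M.B0 * M.B0pinv = 1 := by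
  have h1 : IsUnit (M.B0 * M.B0.transpose) := by
    rw [← Matrix.mulVec_injective_iff_isUnit]
    refine (injective_iff_map_eq_zero (Matrix.mulVecLin _)).2 fun v hv => ?_
    rw [Matrix.mulVecLin_apply, ← Matrix.conjTranspose_eq_transpose_of_trivial,
      Matrix.self_mul_conjTranspose_mulVec_eq_zero,
      Matrix.conjTranspose_eq_transpose_of_trivial, Matrix.mulVec_transpose] at hv
    exact Matrix.vecMul_injective_iff.2 hM.B0_rows (hv.trans (Matrix.zero_vecMul _).symm)
  rw [B0pinv, ← Matrix.mul_assoc,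
    Matrix.mul_nonsing_inv _ ((Matrix.isUnit_iff_isUnit_det _).1 h1)]

/-- The matched form of the error dynamics: the control and the perturbation `Ψ₂` enter through
`I + ΔB`. -/
theorem closed_loop_eq (hM : M.RegionAssumption) (hb : G.b ≠ 0) {t : ℝ}
    {Δ : Matrix (Fin mu ⊕ Fin mR) (Fin mu ⊕ Fin mR) ℝ} {Ψ₂ Ψbar : Out mu mR}
    (hB : M.B X t = (1 + Δ) * M.B0) (hΔ : ‖op Δ‖ < 1)
    (hΨ : Ψbar = (1 / G.b) • op (1 + Δ)⁻¹ Ψ₂) :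
    Ψ₂ + WithLp.toLp 2 ((M.B X t).mulVec (M.Q G X t)) =
      op (1 + Δ) (-(G.k₁ • G.φ₁ (M.σ X t)) + G.b • (X.ν t + Ψbar)) := by
  have h1 : WithLp.toLp 2 ((M.B X t).mulVec (M.Q G X t)) =
      op (1 + Δ) (-(G.k₁ • G.φ₁ (M.σ X t)) + G.b • X.ν t) := by
    rw [hB, Q, Matrix.mulVec_mulVec, Matrix.mul_assoc, B0_mul_B0pinv hM, Matrix.mul_one,
      ← op_toLp_mulVec, WithLp.toLp_ofLp]
  have h2 : Ψ₂ = op (1 + Δ) (G.b • Ψbar) := by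
    rw [hΨ, smul_smul, mul_one_div_cancel hb, one_smul, op_one_add_inv hΔ]
  rw [h1, h2, ← map_add, smul_add]
  congr 1
  abel

/-- The closed loop is brought to the form required by `lyapunovDeriv_le`. The summands `+ 1` in
`hE` are the room for the higher-order terms; `hρ₁` and `hρ₂` say that these terms fit when `‖σ‖ <
ρ`. -/
theorem decaysAlong {D : Bounds} {ΔB : ℝ → Matrix (Fin mu ⊕ Fin mR) (Fin mu ⊕ Fin mR) ℝ}
    {Ψ₁ Ψ₂ Ψbar : ℝ → Out mu mR} (hM : M.Admissible) (hX : M.IsSolution G τ X)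
    (hP : M.PerturbationBounds G D τ X ΔB Ψ₁ Ψ₂ Ψbar) (hT : T ∈ horizon τ) (hT0 : 0 < T)
    (hα₁ : 0 < G.α₁) (hα₂ : 0 < G.α₂) (hb : 0 < G.b) (hk₁ : 0 < G.k₁) (hk₂ : 0 < G.k₂)
    (hδB : D.δB < 1) (hδ₁ : 0 < D.δ₁) (hδ₂ : 0 < D.δ₂) (hδ₄ : 0 < D.δ₄)
    {ε h ρ : ℝ} (hε : 0 < ε) (hε1 : ε ≤ 1)
    (hh : h = G.b * (G.k₂ * (G.α₁ ^ 2 / 2)) / (G.k₁ * G.α₁) ^ 2)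
    (hδ : 2 * (1 + ε) * h ≤ 1 - D.δB)
    (hE : 2 * (D.δ₁ + 1) / (G.k₁ * G.α₁) + 2 * G.b * (D.δ₃ + 1) / (G.k₁ * G.α₁) ^ 2 ≤ h * ε / 10)
    (hρ₁ : (D.δ₂ + 2 * G.k₁ * G.α₂) * √ρ ≤ 1)
    (hρ₂ : D.δ₄ * ρ + G.k₂ * (3 / 2 * G.α₁ * G.α₂ * √ρ + G.α₂ ^ 2 * ρ) ≤ 1) :
    DecaysAlong (G.k₁ * G.α₁) G.b ρ (h * ε / 10) T (M.σ X) (fun t => X.ν t + Ψbar t) := by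
  obtain ⟨hσac, hσ⟩ := hX.error_dynamics hM hT hT0
  refine ⟨hσac, (hX.ν_ac T hT).fun_add (hP.Ψbar_ac T hT), ?_⟩
  filter_upwards [hσ, ae_Icc_of_ae_horizon hT hX.ν_eq, ae_Icc_of_ae_horizon hT hP.B_eq,
    ae_Icc_of_ae_horizon hT hP.ΔB_le, ae_Icc_of_ae_horizon hT hP.Ψ_eq,
    ae_Icc_of_ae_horizon hT hP.Ψ₁_le, ae_Icc_of_ae_horizon hT hP.Ψbar_eq,
    ae_Icc_of_ae_horizon hT hP.Ψbar_deriv_le,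
    (hP.Ψbar_ac T hT).boundedVariationOn.ae_differentiableAt_of_mem_uIcc]
    with t h1 h2 h3 h4 h5 h6 h7 h8 h9 ht hsmall
  obtain ⟨w, hw, hν⟩ := h2 ht
  obtain ⟨s, hs, hz, rfl⟩ := G.exists_of_mem_filippov_φ₂ hα₁ hα₂ hw
  have hΨbar := (h9 (by rwa [uIcc_of_le hT.1])).hasDerivAt
  refine ⟨_, _, h1 ht, hν.add hΨbar, ?_⟩
  have hz' : M.Ψ X t + WithLp.toLp 2 ((M.B X t).mulVec (M.Q G X t)) =
      Ψ₁ t + op (1 + ΔB t) (-(G.k₁ • G.φ₁ (M.σ X t)) + G.b • (X.ν t + Ψbar t)) := by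
    rw [h5 ht, add_assoc, closed_loop_eq hM.regions hb.ne' (h3 ht) ((h4 ht).trans_lt hδB) (h7 ht)]
  rw [hz', G.φ₁_eq hz]
  set z := M.σ X t with hzdef
  set y := X.ν t + Ψbar t with hydef
  set r := ‖z‖ with hr
  have hr0 : 0 ≤ r := norm_nonneg z
  have hrρ : r ≤ ρ := hsmall.le
  have hsq : r = √r * √r := (Real.mul_self_sqrt hr0).symm
  have hsqle : √r ≤ √ρ := Real.sqrt_le_sqrt hrρ
  set κ := G.k₁ * G.α₁ with hκ
  set v := G.b • y - (κ * √r) • s with hv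
  have e1 : Ψ₁ t + op (1 + ΔB t) (-(G.k₁ • ((G.α₁ * √r) • s + G.α₂ • z)) + G.b • y) =
      v + op (ΔB t) v + (Ψ₁ t - op (1 + ΔB t) ((G.k₁ * G.α₂) • z)) := by
    have : -(G.k₁ • ((G.α₁ * √r) • s + G.α₂ • z)) + G.b • y = v - (G.k₁ * G.α₂) • z := by
      rw [hv, hκ]; module
    rw [this, map_sub, op_one_add (ΔB t) v]
    abel
  have e2 : -(G.k₂ • ((G.α₁ ^ 2 / 2 + 3 / 2 * G.α₁ * G.α₂ * √r + G.α₂ ^ 2 * r) • s)) +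
      deriv Ψbar t = -((G.k₂ * (G.α₁ ^ 2 / 2)) • s) +
        (deriv Ψbar t - (G.k₂ * (3 / 2 * G.α₁ * G.α₂ * √r + G.α₂ ^ 2 * r)) • s) := by
    module
  rw [e1, e2]
  refine lyapunovDeriv_le (δ := D.δB) (E₁ := D.δ₁ + 1) (E₂ := D.δ₃ + 1) (by positivity) hb hε hε1
    hh (by positivity) (by positivity) hδ hE hs hz ?_ ?_ ?_
  · exact ((op (ΔB t)).le_opNorm v).trans
      (mul_le_mul_of_nonneg_right (h4 ht) (norm_nonneg v))
  -- The factor `2` bounds `1 + ‖ΔB‖`.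
  · have i1 : ‖op (1 + ΔB t) ((G.k₁ * G.α₂) • z)‖ ≤ 2 * (G.k₁ * G.α₂) * r := by
      rw [op_one_add]
      have i2 : ‖(G.k₁ * G.α₂) • z‖ = G.k₁ * G.α₂ * r := by
        rw [norm_smul, Real.norm_of_nonneg (by positivity)]
      have i3 := (op (ΔB t)).le_of_opNorm_le ((h4 ht).trans hδB.le) ((G.k₁ * G.α₂) • z)
      have i4 := norm_add_le ((G.k₁ * G.α₂) • z) (op (ΔB t) ((G.k₁ * G.α₂) • z))
      linarith
    have i5 := h6 ht
    rw [← Real.sqrt_eq_rpow] at i5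
    have i6 : (D.δ₂ + 2 * G.k₁ * G.α₂) * √r ≤ 1 :=
      (mul_le_mul_of_nonneg_left hsqle (by positivity)).trans hρ₁
    have i7 := mul_le_mul_of_nonneg_right i6 (Real.sqrt_nonneg r)
    have i8 : (D.δ₂ + 2 * G.k₁ * G.α₂) * √r * √r = (D.δ₂ + 2 * G.k₁ * G.α₂) * r := by
      rw [mul_assoc, ← hsq]
    have i9 := norm_sub_le (Ψ₁ t) (op (1 + ΔB t) ((G.k₁ * G.α₂) • z))
    linarith
  · have i1 := h8 ht
    have i2 : ‖(G.k₂ * (3 / 2 * G.α₁ * G.α₂ * √r + G.α₂ ^ 2 * r)) • s‖ ≤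
        G.k₂ * (3 / 2 * G.α₁ * G.α₂ * √ρ + G.α₂ ^ 2 * ρ) := by
      rw [norm_smul, Real.norm_of_nonneg (by positivity)]
      refine (mul_le_of_le_one_right (by positivity) hs).trans ?_
      gcongr
    have i3 := mul_le_mul_of_nonneg_left hrρ hδ₄.le
    have i4 := norm_sub_le (deriv Ψbar t)
      ((G.k₂ * (3 / 2 * G.α₁ * G.α₂ * √r + G.α₂ ^ 2 * r)) • s)
    linarith

end Model

/-! ### Choice of the gains and conclusion -/

theorem exists_small_radius (A B C : ℝ) :
    ∃ ρ : ℝ, 0 < ρ ∧ A * √ρ ≤ 1 ∧ B * ρ + C * √ρ ≤ 1 := by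
  have h1 : Tendsto (fun x : ℝ => A * √x) (𝓝[>] 0) (𝓝 0) := by
    have : Continuous fun x : ℝ => A * √x := by fun_prop
    simpa using (this.tendsto 0).mono_left nhdsWithin_le_nhds
  have h2 : Tendsto (fun x : ℝ => B * x + C * √x) (𝓝[>] 0) (𝓝 0) := by
    have : Continuous fun x : ℝ => B * x + C * √x := by fun_prop
    simpa using (this.tendsto 0).mono_left nhdsWithin_le_nhds
  obtain ⟨ρ, ⟨h3, h4⟩, h5⟩ := ((h1.eventually (ge_mem_nhds one_pos)).and
    (h2.eventually (ge_mem_nhds one_pos)) |>.and self_mem_nhdsWithin).exists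
  exact ⟨ρ, h5, h3, h4⟩

/-- The margin in the gain condition. -/
theorem exists_gain_margin {b δB kbar₁ kbar₂ : ℝ} (hb : 0 < b) (hδB1 : δB < 1)
    (hkbar₂ : 0 < kbar₂) (hkbar₁ : √(b * kbar₂ / (1 - δB)) < kbar₁) :
    ∃ ε : ℝ, 0 < ε ∧ ε ≤ 1 ∧ 2 * (1 + ε) * (b * kbar₂ / (2 * kbar₁ ^ 2)) ≤ 1 - δB := by
  have h1 : 0 < 1 - δB := sub_pos.2 hδB1
  have hk : 0 < kbar₁ := (Real.sqrt_nonneg _).trans_lt hkbar₁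
  have h2 : b * kbar₂ / (1 - δB) < kbar₁ ^ 2 := (Real.sqrt_lt' hk).1 hkbar₁
  have h3 : b * kbar₂ < kbar₁ ^ 2 * (1 - δB) := (div_lt_iff₀ h1).1 h2
  have h4 : 0 < b * kbar₂ := by positivity
  -- The second argument of `min` is the value of `ε` that turns the required inequality into an
  -- equality.
  refine ⟨min 1 ((kbar₁ ^ 2 * (1 - δB) - b * kbar₂) / (b * kbar₂)), ?_, min_le_left _ _, ?_⟩
  · exact lt_min one_pos (div_pos (sub_pos.2 h3) h4)
  · have h5 := min_le_right 1 ((kbar₁ ^ 2 * (1 - δB) - b * kbar₂) / (b * kbar₂))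
    rw [le_div_iff₀ h4] at h5
    have h6 : ∀ e : ℝ, 2 * (1 + e) * (b * kbar₂ / (2 * kbar₁ ^ 2)) =
        (1 + e) * (b * kbar₂) / kbar₁ ^ 2 := fun e => by field_simp
    rw [h6, div_le_iff₀ (by positivity)]
    linarith

end Seismicity

end

theorem theorem1 (mu mR n : ℕ) (α₁ α₂ b δB δ₁ δ₂ δ₃ δ₄ : ℝ)
    (hα₁ : 0 < α₁) (hα₂ : 0 < α₂) (hb : 0 < b)
    (hδB : 0 < δB) (hδB1 : δB < 1) (hδ₁ : 0 < δ₁) (hδ₂ : 0 < δ₂) (hδ₃ : 0 < δ₃) (hδ₄ : 0 < δ₄)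
    (kbar₁ kbar₂ : ℝ) (hkbar₂ : 0 < kbar₂) (hkbar₁ : Real.sqrt (b * kbar₂ / (1 - δB)) < kbar₁) :
    ∃ l₀ : ℝ, 0 < l₀ ∧ ∀ l : ℝ, l₀ ≤ l →
      ∀ M : Seismicity.Model mu mR n, M.Admissible →
        Seismicity.LocallyFiniteTimeStable
          (M.ErrorTrajectory
            { α₁ := α₁, α₂ := α₂, b := b, k₁ := l * kbar₁, k₂ := l ^ 2 * kbar₂ }
            { δB := δB, δ₁ := δ₁, δ₂ := δ₂, δ₃ := δ₃, δ₄ := δ₄ }) := by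
  obtain ⟨ε, hε, hε1, hgain⟩ := Seismicity.exists_gain_margin hb hδB1 hkbar₂ hkbar₁
  have hk : 0 < kbar₁ := (Real.sqrt_nonneg _).trans_lt hkbar₁
  set h := b * kbar₂ / (2 * kbar₁ ^ 2) with hh
  have hh0 : 0 < h := by positivity
  set κ := kbar₁ * α₁ with hκ
  have hκ0 : 0 < κ := by positivity
  set A := 2 * (δ₁ + 1) / κ + 2 * b * (δ₃ + 1) / κ ^ 2 with hA
  have hA0 : 0 < A := by positivity
  -- The bound `1 ≤ l` lets `1 / l²` be replaced by `1 / l`, so that both error terms together are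
  -- at most `A / l`.
  refine ⟨max 1 (A / (h * ε / 10)), by positivity, fun l hl M hM => ?_⟩
  have hl1 : 1 ≤ l := (le_max_left _ _).trans hl
  have hl0 : 0 < l := one_pos.trans_le hl1
  have hl2 : A / l ≤ h * ε / 10 := by
    rw [div_le_iff₀ hl0, mul_comm, ← div_le_iff₀ (by positivity)]
    exact (le_max_right _ _).trans hl
  -- The radius may depend on `l`, since the stability claimed for each `l` is local; `l₀` does not
  -- involve `ρ`.
  obtain ⟨ρ, hρ, hρ₁, hρ₂⟩ := Seismicity.exists_small_radius
    (A := δ₂ + 2 * (l * kbar₁) * α₂) (B := δ₄ + l ^ 2 * kbar₂ * α₂ ^ 2)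
    (C := l ^ 2 * kbar₂ * (3 / 2 * α₁ * α₂))
  refine Seismicity.locallyFiniteTimeStable_of_decaysAlong (κ := l * kbar₁ * α₁) (b := b) (ρ := ρ)
    (μ := h * ε / 10) (by positivity) hb hρ (by positivity) fun τ x hx => ?_
  obtain ⟨X, ΔB, Ψ₁, Ψ₂, Ψbar, hX, hP, hxy⟩ := hx
  refine ⟨M.σ X, fun t => X.ν t + Ψbar t, hxy, fun T hT hT0 => ?_⟩
  refine Seismicity.Model.decaysAlong hM hX hP hT hT0 hα₁ hα₂ hb (by positivity) (by positivity)
    hδB1 hδ₁ hδ₂ hδ₄ hε hε1 ?_ hgain ?_ hρ₁ ?_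
  · simp only [hh]; field_simp
  · refine le_trans ?_ hl2
    have e1 : 2 * (δ₁ + 1) / (l * kbar₁ * α₁) = 2 * (δ₁ + 1) / κ / l := by
      rw [hκ]; field_simp
    have e2 : 2 * b * (δ₃ + 1) / (l * kbar₁ * α₁) ^ 2 ≤ 2 * b * (δ₃ + 1) / κ ^ 2 / l := by
      have e3 : κ ^ 2 * l ≤ (l * kbar₁ * α₁) ^ 2 := by
        rw [hκ]
        nlinarith [mul_nonneg (mul_nonneg (sq_nonneg (kbar₁ * α₁)) hl0.le) (sub_nonneg.2 hl1)]
      rw [div_div]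
      gcongr
    rw [hA, add_div]
    exact add_le_add e1.le e2
  · refine le_trans (le_of_eq ?_) hρ₂
    ring
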